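/- Let $M$ be a smooth $n$-dimensional manifold and let $H\in\Omega^3(M)$ be a closed $3$-form, written in local coordinates $q^1,\dots,q^n$ of $M$ as $H=\tfrac16\phi_{ijk}(q)\,dq^i\wedge dq^j\wedge dq^k$ with $\phi_{ijk}$ totally antisymmetric (repeated indices are summed). An *NQ manifold of degree $2$* (equivalently, a Lie $2$-algebroid) over $M$ is a sheaf on $M$ of non-negatively graded, graded-commutative algebras, locally freely generated over the smooth functions of $M$ by finitely many coordinates of degrees $1$ and $2$, together with a degree $1$ derivation $Q$ of this sheaf with $Q^2=0$ (the homological vector field). An *isomorphism* of NQ manifolds is a diffeomorphism of the bodies together with an isomorphism over it of the sheaves of graded algebras (extending the pullback of functions of the bodies) that intertwines the homological vector fields; no compatibility with symplectic forms is required. Let $T^*[2]T[1]M$ be the graded manifold with body $M$ which over each coordinate domain of $M$ has coordinates $(q^i,\xi^i,p_i,\theta_i)$ of degrees $0,1,2,1$, where under a change of coordinates $q\mapsto q'$ of $M$ $$\xi'^i=\frac{\partial q'^i}{\partial q^j}\xi^j,\qquad \theta'_i=\frac{\partial q^j}{\partial q'^i}\theta_j,\qquad p'_i=\frac{\partial q^j}{\partial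 q'^i}p_j+\frac{\partial}{\partial q^k}\Big(\frac{\partial q^j}{\partial q'^i}\Big)\xi^k\theta_j .$$ The *exact Courant algebroid with Ševera class $[H]\in H^3(M,\mathbb R)$* is the NQ manifold $(T^*[2]T[1]M,Q_H)$ with homological vector field $$Q_H=\xi^i\frac{\partial}{\partial q^i}+p_i\frac{\partial}{\partial\theta_i}+\frac16\frac{\partial\phi_{ijk}}{\partial q^l}\xi^i\xi^j\xi^k\frac{\partial}{\partial p_l}-\frac12\phi_{ijk}\xi^i\xi^j\frac{\partial}{\partial\theta_k},$$ the Hamiltonian vector field of $\xi^ip_i-\tfrac16\phi_{ijk}\xi^i\xi^j\xi^k$. For $H=0$ it is the standard Courant algebroid, which has zero Ševera class. Then for every closed $3$-form $H$ the exact Courant algebroid $(T^*[2]T[1]M,Q_H)$ with Ševera class $[H]$ is isomorphic, as an NQ manifold (Lie $2$-algebroid), to the standard Courant algebroid $(T^*[2]T[1]M,Q_0)$. -/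

import Mathlib

namespace NQ

open scoped BigOperators

section FreeGC

universe u v

/-- Degree of a generator: elements of the coefficient ring `R` have degree `0`, the free
generator `g` has degree `w g`. -/
def genDeg {R : Type u} {G : Type v} (w : G → ℕ) : R ⊕ G → ℕ := Sum.elim (fun _ => 0) w

/-- The defining relations of the free graded-commutative algebra: the ring structure of `R`, and
graded commutativity of all generators. -/
inductive GCRel (R : Type u) {G : Type v} [CommRing R] [Algebra ℝ R] (w : G → ℕ) :
    FreeAlgebra ℝ (R ⊕ G) → FreeAlgebra ℝ (R ⊕ G) → Prop
  | add (f g : R) : GCRel R w (FreeAlgebra.ι ℝ (Sum.inl (f + g)))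
      (FreeAlgebra.ι ℝ (Sum.inl f) + FreeAlgebra.ι ℝ (Sum.inl g))
  | mul (f g : R) : GCRel R w (FreeAlgebra.ι ℝ (Sum.inl (f * g)))
      (FreeAlgebra.ι ℝ (Sum.inl f) * FreeAlgebra.ι ℝ (Sum.inl g))
  | const (c : ℝ) : GCRel R w (FreeAlgebra.ι ℝ (Sum.inl (algebraMap ℝ R c)))
      (algebraMap ℝ (FreeAlgebra ℝ (R ⊕ G)) c)
  | comm (a b : R ⊕ G) : GCRel R w (FreeAlgebra.ι ℝ a * FreeAlgebra.ι ℝ b)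
      ((-1 : ℝ) ^ (genDeg w a * genDeg w b) • (FreeAlgebra.ι ℝ b * FreeAlgebra.ι ℝ a))

/-- The free graded-commutative algebra over the (degree `0`) commutative `ℝ`-algebra `R`, on the
homogeneous generators `g : G` of degree `w g`; that is `R ⊗ Λ(odd generators) ⊗ S(even generators)`.
(An odd element squares to zero since `x * x = - (x * x)`.) -/
def FreeGC (R : Type u) {G : Type v} [CommRing R] [Algebra ℝ R] (w : G → ℕ) : Type (max u v) :=
  RingQuot (GCRel R w)

namespace FreeGC

variable {R : Type u} {G : Type v} [CommRing R] [Algebra ℝ R] (w : G → ℕ)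

noncomputable instance : Ring (FreeGC R w) := inferInstanceAs (Ring (RingQuot (GCRel R w)))

noncomputable instance : Algebra ℝ (FreeGC R w) :=
  inferInstanceAs (Algebra ℝ (RingQuot (GCRel R w)))

/-- The class of a generator. -/
noncomputable def mk (a : R ⊕ G) : FreeGC R w :=
  RingQuot.mkAlgHom ℝ (GCRel R w) (FreeAlgebra.ι ℝ a)

/-- The inclusion of the coefficient ring, as degree `0` elements. -/
noncomputable def fn : R →ₐ[ℝ] FreeGC R w where
  toFun f := mk w (Sum.inl f)
  map_one' := by
    have := RingQuot.mkAlgHom_rel ℝ (GCRel.const (R := R) (w := w) 1)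
    rw [map_one, map_one, map_one] at this; exact this
  map_mul' f g := by
    have := RingQuot.mkAlgHom_rel ℝ (GCRel.mul (R := R) (w := w) f g)
    rw [map_mul] at this; exact this
  map_zero' := by
    have := RingQuot.mkAlgHom_rel ℝ (GCRel.const (R := R) (w := w) 0)
    rw [map_zero, map_zero, map_zero] at this; exact this
  map_add' f g := by
    have := RingQuot.mkAlgHom_rel ℝ (GCRel.add (R := R) (w := w) f g)
    rw [map_add] at this; exact this
  commutes' c := by
    have := RingQuot.mkAlgHom_rel ℝ (GCRel.const (R := R) (w := w) c)
    rw [AlgHom.commutes] at this; exact this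

/-- The free generators. -/
noncomputable def gen (R : Type u) [CommRing R] [Algebra ℝ R] {G : Type v} (w : G → ℕ) (g : G) :
    FreeGC R w := mk w (Sum.inr g)

theorem mk_inl (f : R) : mk w (Sum.inl f) = fn w f := rfl
theorem mk_inr (g : G) : mk w (Sum.inr g) = gen R w g := rfl

theorem mk_comm (a b : R ⊕ G) :
    mk w a * mk w b = (-1 : ℝ) ^ (genDeg w a * genDeg w b) • (mk w b * mk w a) := by
  have := RingQuot.mkAlgHom_rel ℝ (GCRel.comm (R := R) (w := w) a b)
  rw [map_mul, map_smul, map_mul] at this; exact this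

section lift

variable {B : Type*} [Ring B] [Algebra ℝ B]

/-- Universal property. -/
noncomputable def lift (φ : R →ₐ[ℝ] B) (γ : G → B) (h0 : ∀ f g, φ f * γ g = γ g * φ f)
    (h1 : ∀ g h, γ g * γ h = (-1 : ℝ) ^ (w g * w h) • (γ h * γ g)) : FreeGC R w →ₐ[ℝ] B :=
  RingQuot.liftAlgHom ℝ ⟨FreeAlgebra.lift ℝ (Sum.elim φ γ), by
    intro x y h
    induction h with
    | add f g => simp
    | mul f g => simp
    | const c => simp
    | comm a b =>
      rcases a with a | a <;> rcases b with b | b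
      · simp only [genDeg, Sum.elim_inl, zero_mul, pow_zero, one_smul, map_mul,
          FreeAlgebra.lift_ι_apply]
        rw [← map_mul, mul_comm, map_mul]
      · simp [genDeg, h0]
      · simp [genDeg, h0]
      · simp [genDeg]; exact h1 a b⟩

variable {w}

@[simp] theorem lift_fn (φ : R →ₐ[ℝ] B) (γ : G → B) (h0) (h1) (f : R) :
    lift w φ γ h0 h1 (fn w f) = φ f := by
  change RingQuot.liftAlgHom ℝ _ (RingQuot.mkAlgHom ℝ (GCRel R w) _) = _
  rw [RingQuot.liftAlgHom_mkAlgHom_apply]; simp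

@[simp] theorem lift_gen (φ : R →ₐ[ℝ] B) (γ : G → B) (h0) (h1) (g : G) :
    lift w φ γ h0 h1 (gen R w g) = γ g := by
  change RingQuot.liftAlgHom ℝ _ (RingQuot.mkAlgHom ℝ (GCRel R w) _) = _
  rw [RingQuot.liftAlgHom_mkAlgHom_apply]; simp

theorem hom_ext {F F' : FreeGC R w →ₐ[ℝ] B} (h0 : ∀ f, F (fn w f) = F' (fn w f))
    (h1 : ∀ g, F (gen R w g) = F' (gen R w g)) : F = F' := by
  apply RingQuot.ringQuot_ext'
  apply FreeAlgebra.hom_ext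
  funext a
  rcases a with a | a
  · exact h0 a
  · exact h1 a

end lift

variable {w}

theorem induction {P : FreeGC R w → Prop} (hfn : ∀ f, P (fn w f)) (hgen : ∀ g, P (gen R w g))
    (hadd : ∀ x y, P x → P y → P (x + y)) (hmul : ∀ x y, P x → P y → P (x * y)) (x) : P x := by
  obtain ⟨y, rfl⟩ := RingQuot.mkAlgHom_surjective ℝ (GCRel R w) x
  induction y using FreeAlgebra.induction with
  | grade0 c =>
    rw [AlgHom.commutes]
    have := hfn (algebraMap ℝ R c)
    rw [AlgHom.commutes] at this; exact this
  | grade1 a => rcases a with a | a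
                · exact hfn a
                · exact hgen a
  | mul a b ha hb => rw [map_mul]; exact hmul _ _ ha hb
  | add a b ha hb => rw [map_add]; exact hadd _ _ ha hb

variable (R w) in
/-- The homogeneous elements of degree `k`: the span of products of generators of total
degree `k`. -/
noncomputable def deg (k : ℕ) : Submodule ℝ (FreeGC R w) :=
  Submodule.span ℝ {x | ∃ l : List (R ⊕ G), (l.map (genDeg w)).sum = k ∧ x = (l.map (mk w)).prod}

theorem mk_mem (a : R ⊕ G) : mk w a ∈ deg R w (genDeg w a) :=
  Submodule.subset_span ⟨[a], by simp, by simp⟩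

theorem fn_mem (f : R) : fn w f ∈ deg R w 0 := mk_mem (w := w) (Sum.inl f)
theorem gen_mem (g : G) : gen R w g ∈ deg R w (w g) := mk_mem (w := w) (Sum.inr g)

theorem one_mem : (1 : FreeGC R w) ∈ deg R w 0 := Submodule.subset_span ⟨[], by simp, by simp⟩

theorem mul_mem {j k : ℕ} {x y : FreeGC R w} (hx : x ∈ deg R w j) (hy : y ∈ deg R w k) :
    x * y ∈ deg R w (j + k) := by
  have h := Submodule.mul_mem_mul hx hy
  rw [deg, deg, Submodule.span_mul_span] at h
  refine Submodule.span_mono ?_ h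
  rintro _ ⟨_, ⟨l, hl, rfl⟩, _, ⟨l', hl', rfl⟩, rfl⟩
  exact ⟨l ++ l', by simp [hl, hl'], by simp⟩

/-- To show that a linear map sends `deg k` into `N`, compute on products of generators. -/
theorem deg_induction {k : ℕ} {N : Submodule ℝ (FreeGC R w)}
    (h : ∀ l : List (R ⊕ G), (l.map (genDeg w)).sum = k → (l.map (mk w)).prod ∈ N) :
    deg R w k ≤ N := by
  refine Submodule.span_le.2 ?_
  rintro _ ⟨l, hl, rfl⟩
  exact h l hl

/-- An algebra map sending each generator to a homogeneous element of the same degree preserves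
degrees. -/
theorem map_deg {S : Type*} {G' : Type*} [CommRing S] [Algebra ℝ S] {w' : G' → ℕ}
    (F : FreeGC R w →ₐ[ℝ] FreeGC S w') (h0 : ∀ f, F (fn w f) ∈ deg S w' 0)
    (h1 : ∀ g, F (gen R w g) ∈ deg S w' (w g)) {k : ℕ} {x : FreeGC R w} (hx : x ∈ deg R w k) :
    F x ∈ deg S w' k := by
  have : deg R w k ≤ (deg S w' k).comap F.toLinearMap := by
    refine Submodule.span_le.2 ?_
    rintro _ ⟨l, hl, rfl⟩
    subst hl
    clear hx
    change F _ ∈ deg S w' _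
    induction l with
    | nil => simpa using one_mem
    | cons a l ih =>
      simp only [List.map_cons, List.prod_cons, map_mul, List.sum_cons]
      refine mul_mem ?_ ih
      rcases a with a | a
      · exact h0 a
      · exact h1 a
  exact this hx

theorem comm_of_mem {j k : ℕ} {x y : FreeGC R w} (hx : x ∈ deg R w j) (hy : y ∈ deg R w k) :
    x * y = (-1 : ℝ) ^ (j * k) • (y * x) := by
  have step : ∀ (a : R ⊕ G) (l : List (R ⊕ G)),
      mk w a * (l.map (mk w)).prod
        = (-1 : ℝ) ^ (genDeg w a * (l.map (genDeg w)).sum) • ((l.map (mk w)).prod * mk w a) := by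
    intro a l
    induction l with
    | nil => simp
    | cons b l ih =>
      simp only [List.map_cons, List.prod_cons, List.sum_cons]
      rw [← mul_assoc, mk_comm, smul_mul_assoc, mul_assoc, ih, mul_smul_comm, smul_smul, ← pow_add,
        ← mul_add, mul_assoc]
  have step2 : ∀ (l l' : List (R ⊕ G)),
      (l.map (mk w)).prod * (l'.map (mk w)).prod
        = (-1 : ℝ) ^ ((l.map (genDeg w)).sum * (l'.map (genDeg w)).sum) •
          ((l'.map (mk w)).prod * (l.map (mk w)).prod) := by
    intro l l'
    induction l with
    | nil => simp
    | cons b l ih =>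
      simp only [List.map_cons, List.prod_cons, List.sum_cons]
      rw [mul_assoc, ih, mul_smul_comm, ← mul_assoc, step, smul_mul_assoc, smul_smul, ← pow_add,
        mul_assoc, add_mul, add_comm]
  induction hx using Submodule.span_induction with
  | zero => simp
  | add a b _ _ ha hb => rw [add_mul, mul_add, smul_add, ha, hb]
  | smul c a _ ha => rw [smul_mul_assoc, ha, mul_smul_comm, smul_comm]
  | mem x hx =>
    obtain ⟨l, hl, rfl⟩ := hx
    induction hy using Submodule.span_induction with
    | zero => simp
    | add a b _ _ ha hb => rw [add_mul, mul_add, smul_add, ha, hb]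
    | smul c a _ ha => rw [smul_mul_assoc, mul_smul_comm, ha, smul_comm]
    | mem y hy =>
      obtain ⟨l', hl', rfl⟩ := hy
      rw [step2, hl, hl']

/-- Elements of even degree are central. -/
theorem fn_comm (f : R) (x : FreeGC R w) : fn w f * x = x * fn w f := by
  induction x using induction with
  | hfn g => rw [← map_mul, mul_comm, map_mul]
  | hgen g => have := comm_of_mem (fn_mem (w := w) f) (gen_mem (R := R) (w := w) g); simpa using this
  | hadd x y hx hy => rw [mul_add, add_mul, hx, hy]
  | hmul x y hx hy => rw [← mul_assoc, hx, mul_assoc, hy, mul_assoc]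

theorem sq_zero {k : ℕ} (hk : Odd k) {x : FreeGC R w} (hx : x ∈ deg R w k) : x * x = 0 := by
  have h := comm_of_mem hx hx
  rw [(hk.mul hk).neg_one_pow, neg_one_smul] at h
  have h2 : (2 : ℝ) • (x * x) = 0 := by rw [two_smul]; nth_rewrite 1 [h]; simp
  exact (smul_eq_zero.1 h2).resolve_left two_ne_zero

variable (R w) in
/-- The homomorphism multiplying each element of degree `k` by `t ^ k`. -/
noncomputable def gradeHom : FreeGC R w →ₐ[ℝ] Polynomial (FreeGC R w) :=
  lift w ((Polynomial.CAlgHom (R := ℝ)).comp (fn w))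
    (fun g => Polynomial.C (gen R w g) * Polynomial.X ^ (w g))
    (by
      intro f g
      have := fn_comm f (gen R w g)
      simp only [AlgHom.comp_apply, Polynomial.CAlgHom_apply]
      rw [mul_assoc, Polynomial.X_pow_mul, ← mul_assoc, ← mul_assoc, ← Polynomial.C_mul,
        ← Polynomial.C_mul, this])
    (by
      intro g h
      have := comm_of_mem (gen_mem (R := R) (w := w) g) (gen_mem (R := R) (w := w) h)
      simp only [Polynomial.C_mul_X_pow_eq_monomial, Polynomial.monomial_mul_monomial, this,
        add_comm (w h)]
      rw [Polynomial.smul_monomial])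

theorem gradeHom_of_mem {k : ℕ} {x : FreeGC R w} (hx : x ∈ deg R w k) :
    gradeHom R w x = Polynomial.monomial k x := by
  have : deg R w k ≤ LinearMap.eqLocus (gradeHom R w).toLinearMap
      ((Polynomial.monomial k).restrictScalars ℝ) := by
    refine deg_induction ?_
    intro l hl
    subst hl
    clear hx
    change gradeHom R w _ = Polynomial.monomial _ _
    induction l with
    | nil => simp
    | cons a l ih =>
      simp only [List.map_cons, List.prod_cons, List.sum_cons, map_mul, ih]
      rw [← Polynomial.monomial_mul_monomial]
      congr 1
      rcases a with a | a
      · simp [mk_inl, gradeHom, genDeg, Polynomial.CAlgHom_apply]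
      · simp [mk_inr, gradeHom, genDeg, Polynomial.C_mul_X_pow_eq_monomial]
  exact this hx

variable (R w) in
/-- The component of degree `k`. -/
noncomputable def proj (k : ℕ) : FreeGC R w →ₗ[ℝ] FreeGC R w :=
  ((Polynomial.lcoeff (FreeGC R w) k).restrictScalars ℝ).comp (gradeHom R w).toLinearMap

theorem proj_of_mem {j k : ℕ} {x : FreeGC R w} (hx : x ∈ deg R w j) :
    proj R w k x = if j = k then x else 0 := by
  change Polynomial.coeff (gradeHom R w x) k = _
  rw [gradeHom_of_mem hx, Polynomial.coeff_monomial]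

theorem iSup_deg : ⨆ k, deg R w k = ⊤ := by
  rw [eq_top_iff]
  rintro x -
  have key : ∀ {k} {y : FreeGC R w}, y ∈ deg R w k → y ∈ ⨆ k, deg R w k :=
    fun {k} {y} hy => Submodule.mem_iSup_of_mem k hy
  induction x using induction with
  | hfn f => exact key (fn_mem f)
  | hgen g => exact key (gen_mem g)
  | hadd x y hx hy => exact add_mem hx hy
  | hmul x y hx hy =>
    induction hx using Submodule.iSup_induction' with
    | zero => simp
    | add a b _ _ ha hb => rw [add_mul]; exact add_mem ha hb
    | mem i a ha =>
      induction hy using Submodule.iSup_induction' with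
      | zero => simp
      | add c d _ _ hc hd => rw [mul_add]; exact add_mem hc hd
      | mem j c hc => exact key (mul_mem ha hc)

variable (R w) in
/-- The parity involution `x ↦ (-1)^|x| x`. -/
noncomputable def parity : FreeGC R w →ₐ[ℝ] FreeGC R w :=
  lift w (fn w) (fun g => (-1 : ℝ) ^ (w g) • gen R w g)
    (fun f g => by rw [mul_smul_comm, smul_mul_assoc, fn_comm])
    (fun g h => by
      rw [smul_mul_smul_comm, smul_mul_smul_comm, comm_of_mem (gen_mem (R := R) (w := w) g) (gen_mem h),
        smul_comm, mul_comm ((-1 : ℝ) ^ w g)])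

theorem parity_of_mem {k : ℕ} {x : FreeGC R w} (hx : x ∈ deg R w k) :
    parity R w x = (-1 : ℝ) ^ k • x := by
  have : deg R w k ≤ LinearMap.eqLocus (parity R w).toLinearMap
      ((-1 : ℝ) ^ k • (LinearMap.id : FreeGC R w →ₗ[ℝ] FreeGC R w)) := by
    refine deg_induction ?_
    intro l hl
    subst hl
    clear hx
    change parity R w _ = (-1 : ℝ) ^ _ • (_ : FreeGC R w)
    induction l with
    | nil => simp
    | cons a l ih =>
      simp only [List.map_cons, List.prod_cons, List.sum_cons, map_mul, ih]
      have h : parity R w (mk w a) = (-1 : ℝ) ^ (genDeg w a) • mk w a := by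
        rcases a with a | a
        · simp [mk_inl, parity, genDeg]
        · simp [mk_inr, parity, genDeg]
      rw [h]
      change _ * ((-1 : ℝ) ^ (List.map (genDeg w) l).sum • (List.map (mk w) l).prod) = _
      rw [smul_mul_smul_comm, pow_add]
      rfl
  exact this hx

/-- Functoriality in the coefficient ring. -/
noncomputable def map {S : Type*} [CommRing S] [Algebra ℝ S] (w : G → ℕ) (φ : R →ₐ[ℝ] S) :
    FreeGC R w →ₐ[ℝ] FreeGC S w :=
  lift w ((fn w).comp φ) (gen S w) (fun _ _ => fn_comm _ _)
    (fun g h => comm_of_mem (gen_mem g) (gen_mem h))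

@[simp] theorem map_fn {S : Type*} [CommRing S] [Algebra ℝ S] (φ : R →ₐ[ℝ] S) (f : R) :
    map w φ (fn w f) = fn w (φ f) :=
  lift_fn _ _ _ _ _

@[simp] theorem map_gen {S : Type*} [CommRing S] [Algebra ℝ S] (φ : R →ₐ[ℝ] S) (g : G) :
    map w φ (gen R w g) = gen S w g :=
  lift_gen _ _ _ _ _

theorem map_mem {S : Type*} [CommRing S] [Algebra ℝ S] (φ : R →ₐ[ℝ] S) {k : ℕ} {x : FreeGC R w}
    (hx : x ∈ deg R w k) : map w φ x ∈ deg S w k :=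
  map_deg _ (fun f => by simpa using fn_mem _) (fun g => by simpa using gen_mem g) hx

theorem map_id (x : FreeGC R w) : map w (AlgHom.id ℝ R) x = x := by
  have : map w (AlgHom.id ℝ R) = AlgHom.id ℝ (FreeGC R w) := hom_ext (by simp) (by simp)
  rw [this]; rfl

theorem map_map {S T : Type*} [CommRing S] [Algebra ℝ S] [CommRing T] [Algebra ℝ T]
    (φ : R →ₐ[ℝ] S) (ψ : S →ₐ[ℝ] T) (x : FreeGC R w) :
    map w ψ (map w φ x) = map w (ψ.comp φ) x := by
  have : (map w ψ).comp (map w φ) = map w (ψ.comp φ) := hom_ext (by simp) (by simp)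
  rw [← this]; rfl

section derivation

variable (w) (D : R →ₗ[ℝ] FreeGC R w) (hD : ∀ f g, D (f * g) = D f * fn w g + fn w f * D g)
  (γ : G → FreeGC R w)

/-- Auxiliary triangular representation `x ↦ [[(-1)^|x| x, Q x], [0, x]]`. -/
noncomputable def derivHom (hD1 : ∀ f, D f ∈ deg R w 1) (hγ : ∀ g, γ g ∈ deg R w (w g + 1)) :
    FreeGC R w →ₐ[ℝ] Matrix (Fin 2) (Fin 2) (FreeGC R w) :=
  lift w
    { toFun := fun f => !![fn w f, D f; 0, fn w f]
      map_one' := by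
        have : D 1 = 0 := by have := hD 1 1; simpa using this
        simp [this, Matrix.one_fin_two]
      map_mul' := fun f g => by simp [hD, add_comm]
      map_zero' := by ext i j; fin_cases i <;> fin_cases j <;> simp
      map_add' := fun f g => by simp
      commutes' := fun c => by
        have h1 : D 1 = 0 := by have := hD 1 1; simpa using this
        have : D (algebraMap ℝ R c) = 0 := by
          rw [Algebra.algebraMap_eq_smul_one, map_smul, h1, smul_zero]
        ext i j
        fin_cases i <;> fin_cases j <;> simp [this, Matrix.algebraMap_matrix_apply] }
    (fun g => !![(-1 : ℝ) ^ (w g) • gen R w g, γ g; 0, gen R w g])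
    (fun f g => by
      have h := comm_of_mem (hD1 f) (gen_mem (R := R) (w := w) g)
      rw [one_mul] at h
      have h' := fn_comm f (γ g)
      have h'' := fn_comm f (gen R w g)
      simp [h, h', h'', add_comm])
    (fun g h => by
      have e1 := comm_of_mem (gen_mem (R := R) (w := w) g) (gen_mem h)
      have e2 := comm_of_mem (gen_mem (R := R) (w := w) g) (hγ h)
      have e3 := comm_of_mem (hγ g) (gen_mem (R := R) (w := w) h)
      have s : ∀ k : ℕ, ((-1 : ℝ) ^ k) * (-1) ^ k = 1 := fun k => by
        rw [← mul_pow]; simp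
      ext i j
      fin_cases i <;> fin_cases j
      · simp [e1, smul_smul]; congr 1; ring
      · simp only [Matrix.mul_fin_two, Matrix.smul_of,
          Matrix.of_apply, Matrix.smul_cons, Fin.zero_eta, Fin.mk_one, smul_mul_assoc]
        simp [e2, e3, smul_smul, smul_add]
        rw [add_comm]
        congr 1
        · congr 1; rw [add_mul, pow_add, one_mul]
        · congr 1
          rw [mul_add, mul_one, pow_add, mul_comm _ ((-1 : ℝ) ^ w g), ← mul_assoc, s, one_mul]
      · simp
      · simp [e1])

variable {w D γ}
variable (hD1 : ∀ f, D f ∈ deg R w 1) (hγ : ∀ g, γ g ∈ deg R w (w g + 1))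

theorem derivHom_eq (x : FreeGC R w) : derivHom w D hD γ hD1 hγ x 0 0 = parity R w x ∧
    derivHom w D hD γ hD1 hγ x 1 1 = x ∧ derivHom w D hD γ hD1 hγ x 1 0 = 0 := by
  induction x using induction with
  | hfn f => simp [derivHom, parity]
  | hgen g => simp [derivHom, parity]
  | hadd x y hx hy => simp [hx, hy]
  | hmul x y hx hy => simp [hx, hy, Matrix.mul_apply]

variable (w D γ) in
/-- The degree `1` graded derivation with prescribed values on coefficients and generators. -/
noncomputable def deriv : FreeGC R w →ₗ[ℝ] FreeGC R w where
  toFun x := derivHom w D hD γ hD1 hγ x 0 1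
  map_add' x y := by simp
  map_smul' c x := by simp

@[simp] theorem deriv_fn (f : R) : deriv w D hD γ hD1 hγ (fn w f) = D f := by
  simp [deriv, derivHom]

@[simp] theorem deriv_gen (g : G) : deriv w D hD γ hD1 hγ (gen R w g) = γ g := by
  simp [deriv, derivHom]

theorem deriv_mul (x y : FreeGC R w) : deriv w D hD γ hD1 hγ (x * y) =
    deriv w D hD γ hD1 hγ x * y + parity R w x * deriv w D hD γ hD1 hγ y := by
  have hx := derivHom_eq hD hD1 hγ x
  have hy := derivHom_eq hD hD1 hγ y
  simp [deriv, Matrix.mul_apply, hx, hy, add_comm]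

theorem deriv_one : deriv w D hD γ hD1 hγ 1 = 0 := by
  simp [deriv]

theorem deriv_mem {k : ℕ} {x : FreeGC R w} (hx : x ∈ deg R w k) :
    deriv w D hD γ hD1 hγ x ∈ deg R w (k + 1) := by
  have : deg R w k ≤ (deg R w (k + 1)).comap (deriv w D hD γ hD1 hγ) := by
    refine deg_induction ?_
    intro l hl
    clear hx
    change deriv w D hD γ hD1 hγ _ ∈ deg R w _
    induction l generalizing k with
    | nil => simp [deriv_one]
    | cons a l ih =>
      subst hl
      simp only [List.map_cons, List.prod_cons, List.sum_cons]
      rw [deriv_mul, parity_of_mem (mk_mem a)]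
      have hl : (l.map (mk w)).prod ∈ deg R w (l.map (genDeg w)).sum :=
        Submodule.subset_span ⟨l, rfl, rfl⟩
      have ha : deriv w D hD γ hD1 hγ (mk w a) ∈ deg R w (genDeg w a + 1) := by
        rcases a with a | a
        · rw [mk_inl, deriv_fn]; exact hD1 a
        · rw [mk_inr, deriv_gen]; exact hγ a
      refine add_mem ?_ ?_
      · have := mul_mem ha hl
        rwa [add_right_comm] at this
      · rw [smul_mul_assoc, add_assoc]
        exact Submodule.smul_mem _ _ (mul_mem (mk_mem a) (ih rfl))
  exact this hx

end derivation

theorem parity_map {S : Type*} [CommRing S] [Algebra ℝ S] {G' : Type*} {w' : G' → ℕ}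
    (F : FreeGC R w →ₐ[ℝ] FreeGC S w') (h0 : ∀ f, F (fn w f) ∈ deg S w' 0)
    (h1 : ∀ g, F (gen R w g) ∈ deg S w' (w g)) (x : FreeGC R w) :
    parity S w' (F x) = F (parity R w x) := by
  have : (parity S w').comp F = F.comp (parity R w) := by
    refine hom_ext (fun f => ?_) (fun g => ?_)
    · simp only [AlgHom.comp_apply]
      rw [parity_of_mem (h0 f), parity_of_mem (fn_mem f), map_smul]
    · simp only [AlgHom.comp_apply]
      rw [parity_of_mem (h1 g), parity_of_mem (gen_mem g), map_smul]
  exact DFunLike.congr_fun this x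

/-- Two odd derivations are intertwined by a degree preserving algebra map as soon as they are on
coefficients and generators. -/
theorem intertwine {S : Type*} [CommRing S] [Algebra ℝ S] {G' : Type*} {w' : G' → ℕ}
    (F : FreeGC R w →ₐ[ℝ] FreeGC S w') (h0 : ∀ f, F (fn w f) ∈ deg S w' 0)
    (h1 : ∀ g, F (gen R w g) ∈ deg S w' (w g))
    (Q : FreeGC R w →ₗ[ℝ] FreeGC R w) (Q' : FreeGC S w' →ₗ[ℝ] FreeGC S w')
    (hQ : ∀ x y, Q (x * y) = Q x * y + parity R w x * Q y)
    (hQ' : ∀ x y, Q' (x * y) = Q' x * y + parity S w' x * Q' y)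
    (e0 : ∀ f, Q' (F (fn w f)) = F (Q (fn w f)))
    (e1 : ∀ g, Q' (F (gen R w g)) = F (Q (gen R w g))) (x : FreeGC R w) :
    Q' (F x) = F (Q x) := by
  induction x using induction with
  | hfn f => exact e0 f
  | hgen g => exact e1 g
  | hadd x y hx hy => simp [hx, hy]
  | hmul x y hx hy => simp [hQ, hQ', hx, hy, parity_map F h0 h1]

end FreeGC
end FreeGC

theorem iSupIndep_of_proj {ι V V' : Type*} [AddCommGroup V] [Module ℝ V] [AddCommGroup V']
    [Module ℝ V'] [DecidableEq ι] (p : ι → Submodule ℝ V) (incl : V →ₗ[ℝ] V')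
    (hinj : Function.Injective incl) (π : ι → V →ₗ[ℝ] V')
    (h : ∀ i j, ∀ x ∈ p i, π j x = if i = j then incl x else 0) : iSupIndep p := by
  rw [iSupIndep_def]
  intro i
  rw [Submodule.disjoint_def]
  intro x hx hx'
  have h1 : π i x = incl x := by simpa using h i i x hx
  have h2 : (⨆ j, ⨆ (_ : j ≠ i), p j) ≤ LinearMap.ker (π i) := by
    refine iSup_le fun j => iSup_le fun hj y hy => ?_
    simpa [hj] using h j i y hy
  apply hinj
  rw [← h1, map_zero]; exact h2 hx'

end NQ

namespace NQ

open scoped BigOperators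

section coord

universe u

/-- Names of the fibre coordinates of `T*[2]T[1]M` over a coordinate domain of `M`:
`ξⁱ = dqⁱ`, `θᵢ` (conjugate to `ξⁱ`) and `pᵢ` (conjugate to `qⁱ`). -/
inductive CGen (n : ℕ) : Type
  | xi (i : Fin n)
  | th (i : Fin n)
  | p (i : Fin n)

/-- `|ξⁱ| = 1`, `|θᵢ| = 1`, `|pᵢ| = 2`. -/
def cw (n : ℕ) : CGen n → ℕ
  | CGen.xi _ => 1
  | CGen.th _ => 1
  | CGen.p _ => 2

/-- Polynomial functions of `(ξ, θ, p)` with coefficients in `R` (to be `C^∞(W)`, `W` a coordinate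
domain). -/
abbrev CAlg (R : Type u) [CommRing R] [Algebra ℝ R] (n : ℕ) : Type u := FreeGC R (cw n)

variable (R : Type u) [CommRing R] [Algebra ℝ R] (n : ℕ)

/-- Coordinate functions `qⁱ` with their coordinate vector fields `d i = ∂/∂qⁱ`. -/
structure CoordSys where
  q : Fin n → R
  d : Fin n → Derivation ℝ R R
  d_comm : ∀ i j f, d i (d j f) = d j (d i f)
  d_q : ∀ i j, d i (q j) = if i = j then 1 else 0

variable {R n}

/-- `ξⁱ` -/
noncomputable def xi (i : Fin n) : CAlg R n := FreeGC.gen R (cw n) (CGen.xi i)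
/-- `θᵢ` -/
noncomputable def th (i : Fin n) : CAlg R n := FreeGC.gen R (cw n) (CGen.th i)
/-- `pᵢ` -/
noncomputable def pp (i : Fin n) : CAlg R n := FreeGC.gen R (cw n) (CGen.p i)
/-- A function of `q` alone. -/
noncomputable abbrev cf : R →ₐ[ℝ] CAlg R n := FreeGC.fn (cw n)

theorem cf_mem (f : R) : (cf f : CAlg R n) ∈ FreeGC.deg R (cw n) 0 := FreeGC.fn_mem f
theorem xi_mem (i : Fin n) : (xi i : CAlg R n) ∈ FreeGC.deg R (cw n) 1 :=
  FreeGC.gen_mem (R := R) (w := cw n) (CGen.xi i)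
theorem th_mem (i : Fin n) : (th i : CAlg R n) ∈ FreeGC.deg R (cw n) 1 :=
  FreeGC.gen_mem (R := R) (w := cw n) (CGen.th i)
theorem pp_mem (i : Fin n) : (pp i : CAlg R n) ∈ FreeGC.deg R (cw n) 2 :=
  FreeGC.gen_mem (R := R) (w := cw n) (CGen.p i)

theorem cf_mul_mem (f : R) {k : ℕ} {x : CAlg R n} (hx : x ∈ FreeGC.deg R (cw n) k) :
    cf f * x ∈ FreeGC.deg R (cw n) k := by
  have := FreeGC.mul_mem (cf_mem (n := n) f) hx
  rwa [zero_add] at this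

theorem xi_comm (i j : Fin n) : (xi i * xi j : CAlg R n) = - (xi j * xi i) := by
  have := FreeGC.comm_of_mem (xi_mem (R := R) i) (xi_mem j)
  simpa using this

theorem xi_xi_mem (i j : Fin n) : (xi i * xi j : CAlg R n) ∈ FreeGC.deg R (cw n) 2 := by
  have h := FreeGC.mul_mem (xi_mem (R := R) i) (xi_mem j)
  norm_num at h; exact h

theorem xi_th_mem (i j : Fin n) : (xi i * th j : CAlg R n) ∈ FreeGC.deg R (cw n) 2 := by
  have h := FreeGC.mul_mem (xi_mem (R := R) i) (th_mem j)
  norm_num at h; exact h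

theorem xi_xi_xi_mem (i j k : Fin n) :
    (xi i * xi j * xi k : CAlg R n) ∈ FreeGC.deg R (cw n) 3 := by
  have h := FreeGC.mul_mem (xi_xi_mem (R := R) i j) (xi_mem k)
  norm_num at h; exact h

namespace CoordSys

variable (c : CoordSys R n) (φ : Fin n → Fin n → Fin n → R)

/-- `f ↦ ξⁱ ∂f/∂qⁱ`. -/
noncomputable def dd : R →ₗ[ℝ] CAlg R n where
  toFun f := ∑ i, cf (c.d i f) * xi i
  map_add' f g := by simp [add_mul, Finset.sum_add_distrib]
  map_smul' r f := by simp [Finset.smul_sum]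

theorem dd_apply (f : R) : c.dd f = ∑ i, cf (c.d i f) * xi i := rfl

theorem dd_mul (f g : R) : c.dd (f * g) = c.dd f * cf g + cf f * c.dd g := by
  simp only [dd_apply, Derivation.leibniz, smul_eq_mul, map_add, map_mul, Finset.sum_mul,
    Finset.mul_sum, ← Finset.sum_add_distrib]
  refine Finset.sum_congr rfl fun i _ => ?_
  rw [add_mul, add_comm, mul_assoc (cf (c.d i f)), ← FreeGC.fn_comm g (xi i),
    ← mul_assoc (cf (c.d i f)), ← FreeGC.fn_comm g (cf _), mul_assoc (cf f)]

theorem dd_mem (f : R) : c.dd f ∈ FreeGC.deg R (cw n) 1 := by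
  rw [dd_apply]
  exact Submodule.sum_mem _ fun i _ => cf_mul_mem _ (xi_mem i)

/-- The contraction `ι_{∂ₖ}` of the `3`-form `(1/6) φᵢⱼₖ ξⁱξʲξᵏ`, i.e. `(1/2) φᵢⱼₖ ξⁱξʲ`. -/
noncomputable def contr (φ : Fin n → Fin n → Fin n → R) (k : Fin n) : CAlg R n :=
  (1 / 2 : ℝ) • ∑ i, ∑ j, cf (φ i j k) * (xi i * xi j)

theorem contr_mem (k : Fin n) : contr φ k ∈ FreeGC.deg R (cw n) 2 := by
  refine Submodule.smul_mem _ _ (Submodule.sum_mem _ fun i _ => Submodule.sum_mem _ fun j _ => ?_)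
  exact cf_mul_mem _ (xi_xi_mem i j)

/-- `Xᵢⱼₖ ξⁱξʲξᵏ` -/
noncomputable def cubic (X : Fin n → Fin n → Fin n → R) : CAlg R n :=
  ∑ i, ∑ j, ∑ k, cf (X i j k) * (xi i * xi j * xi k)

theorem cubic_mem (X : Fin n → Fin n → Fin n → R) : cubic X ∈ FreeGC.deg R (cw n) 3 := by
  refine Submodule.sum_mem _ fun i _ => Submodule.sum_mem _ fun j _ => Submodule.sum_mem _
    fun k _ => ?_
  exact cf_mul_mem _ (xi_xi_xi_mem i j k)

/-- Values of `Q` on the fibre coordinates: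
`Q ξⁱ = 0`, `Q θₖ = pₖ - (1/2) φᵢⱼₖ ξⁱξʲ`, `Q pₗ = (1/6) (∂φᵢⱼₖ/∂qˡ) ξⁱξʲξᵏ`. -/
noncomputable def Qgen : CGen n → CAlg R n
  | CGen.xi _ => 0
  | CGen.th k => pp k - contr φ k
  | CGen.p l => (1 / 6 : ℝ) • cubic fun i j k => c.d l (φ i j k)

theorem Qgen_mem (g : CGen n) : c.Qgen φ g ∈ FreeGC.deg R (cw n) (cw n g + 1) := by
  rcases g with i | i | i
  · exact Submodule.zero_mem _
  · exact Submodule.sub_mem _ (pp_mem _) (contr_mem _ _)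
  · exact Submodule.smul_mem _ _ (cubic_mem _)

/-- The degree `1` vector field
`Q = ξⁱ ∂/∂qⁱ + pᵢ ∂/∂θᵢ + (1/6) (∂φᵢⱼₖ/∂qˡ) ξⁱξʲξᵏ ∂/∂pₗ - (1/2) φᵢⱼₖ ξⁱξʲ ∂/∂θₖ`,
the Hamiltonian vector field of `ξⁱpᵢ - (1/6) φᵢⱼₖ ξⁱξʲξᵏ`. -/
noncomputable def Q : CAlg R n →ₗ[ℝ] CAlg R n :=
  FreeGC.deriv (cw n) c.dd c.dd_mul (c.Qgen φ) c.dd_mem (c.Qgen_mem φ)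

theorem Q_mul (x y : CAlg R n) :
    c.Q φ (x * y) = c.Q φ x * y + FreeGC.parity R (cw n) x * c.Q φ y :=
  FreeGC.deriv_mul _ _ _ _ _

theorem Q_mem {k : ℕ} {x : CAlg R n} (hx : x ∈ FreeGC.deg R (cw n) k) :
    c.Q φ x ∈ FreeGC.deg R (cw n) (k + 1) := FreeGC.deriv_mem _ _ _ hx

theorem Q_cf (f : R) : c.Q φ (cf f) = ∑ i, cf (c.d i f) * xi i := FreeGC.deriv_fn _ _ _ _
theorem Q_xi (i : Fin n) : c.Q φ (xi i) = 0 := FreeGC.deriv_gen _ _ _ _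
theorem Q_th (k : Fin n) : c.Q φ (th k) = pp k - contr φ k := FreeGC.deriv_gen _ _ _ _
theorem Q_pp (l : Fin n) : c.Q φ (pp l) = (1 / 6 : ℝ) • cubic fun i j k => c.d l (φ i j k) :=
  FreeGC.deriv_gen _ _ _ _

theorem Q_cf_mul (f : R) (x : CAlg R n) :
    c.Q φ (cf f * x) = (∑ i, cf (c.d i f) * xi i) * x + cf f * c.Q φ x := by
  rw [Q_mul, Q_cf, FreeGC.parity_of_mem (cf_mem f)]; simp

theorem parity_Q (x : CAlg R n) :
    FreeGC.parity R (cw n) (c.Q φ x) = - c.Q φ (FreeGC.parity R (cw n) x) := by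
  induction x using FreeGC.induction with
  | hfn f =>
    rw [FreeGC.parity_of_mem (c.Q_mem φ (cf_mem f)), FreeGC.parity_of_mem (cf_mem f)]; simp
  | hgen g =>
    rw [FreeGC.parity_of_mem (c.Q_mem φ (FreeGC.gen_mem g)),
      FreeGC.parity_of_mem (FreeGC.gen_mem g), pow_succ]
    simp
  | hadd x y hx hy => simp only [map_add, hx, hy]; abel
  | hmul x y hx hy => simp only [map_mul, map_add, Q_mul, hx, hy]; simp; abel

theorem QQ_mul {x y : CAlg R n} (hx : c.Q φ (c.Q φ x) = 0) (hy : c.Q φ (c.Q φ y) = 0) :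
    c.Q φ (c.Q φ (x * y)) = 0 := by
  simp only [Q_mul, map_add, hx, hy, parity_Q]; simp

theorem sum_symm {s : Fin n → Fin n → R} (hs : ∀ i j, s i j = s j i) :
    ∑ i, ∑ j, (cf (s i j) * (xi i * xi j) : CAlg R n) = 0 := by
  have h : ∑ i, ∑ j, (cf (s i j) * (xi i * xi j) : CAlg R n)
      = - ∑ i, ∑ j, (cf (s i j) * (xi i * xi j) : CAlg R n) := by
    nth_rewrite 1 [Finset.sum_comm]
    simp only [← Finset.sum_neg_distrib]
    refine Finset.sum_congr rfl fun i _ => Finset.sum_congr rfl fun j _ => ?_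
    rw [hs j i, xi_comm j i, mul_neg]
  have h2 : (2 : ℝ) • ∑ i, ∑ j, (cf (s i j) * (xi i * xi j) : CAlg R n) = 0 := by
    rw [two_smul]; nth_rewrite 1 [h]; simp
  exact (smul_eq_zero.1 h2).resolve_left two_ne_zero

theorem Q_dd (f : R) : c.Q φ (c.dd f) = 0 := by
  rw [dd_apply, map_sum]
  simp only [Q_cf_mul, Q_xi, mul_zero, add_zero, Finset.sum_mul, mul_assoc]
  rw [Finset.sum_comm]
  exact sum_symm fun i j => c.d_comm _ _ _

theorem QQ_cf (f : R) : c.Q φ (c.Q φ (cf f)) = 0 := by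
  rw [Q_cf, ← dd_apply]; exact c.Q_dd φ f

theorem QQ_xi (i : Fin n) : c.Q φ (c.Q φ (xi i)) = 0 := by rw [Q_xi, map_zero]

theorem QQ_contr (ψ : Fin n → Fin n → Fin n → R) (k : Fin n) :
    c.Q φ (c.Q φ (contr ψ k)) = 0 := by
  rw [contr, map_smul, map_smul, map_sum, map_sum, Finset.sum_eq_zero, smul_zero]
  intro i _
  rw [map_sum, map_sum, Finset.sum_eq_zero]
  intro j _
  exact c.QQ_mul φ (c.QQ_cf φ _) (c.QQ_mul φ (c.QQ_xi φ _) (c.QQ_xi φ _))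

/-- `φ` is closed: `∂ᵢφⱼₖₗ - ∂ⱼφᵢₖₗ + ∂ₖφᵢⱼₗ - ∂ₗφᵢⱼₖ = 0`. -/
def IsClosedForm : Prop := ∀ i j k l,
  c.d i (φ j k l) - c.d j (φ i k l) + c.d k (φ i j l) - c.d l (φ i j k) = 0

theorem cubic_swap (X : Fin n → Fin n → Fin n → R) :
    cubic (fun i j k => X j i k) = - cubic X := by
  rw [cubic, cubic, Finset.sum_comm]
  simp only [← Finset.sum_neg_distrib]
  refine Finset.sum_congr rfl fun i _ => Finset.sum_congr rfl fun j _ =>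
    Finset.sum_congr rfl fun k _ => ?_
  rw [xi_comm j i]; simp

theorem cubic_swap' (X : Fin n → Fin n → Fin n → R) :
    cubic (fun i j k => X i k j) = - cubic X := by
  rw [cubic, cubic]
  simp only [← Finset.sum_neg_distrib]
  refine Finset.sum_congr rfl fun i _ => ?_
  rw [Finset.sum_comm]
  refine Finset.sum_congr rfl fun j _ => Finset.sum_congr rfl fun k _ => ?_
  rw [mul_assoc, xi_comm k j]; simp [mul_assoc]

theorem cubic_add (X Y : Fin n → Fin n → Fin n → R) :
    cubic (fun i j k => X i j k + Y i j k) = cubic X + cubic Y := by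
  simp [cubic, add_mul, Finset.sum_add_distrib]

theorem Q_contr (k : Fin n) (ψ : Fin n → Fin n → Fin n → R) :
    c.Q φ (contr ψ k) = (1 / 2 : ℝ) • cubic fun m i j => c.d m (ψ i j k) := by
  rw [contr, map_smul, cubic]
  congr 1
  simp only [map_sum, Q_cf_mul]
  simp only [Q_mul, Q_xi, mul_zero, zero_mul, add_zero, Finset.sum_mul]
  conv_rhs => rw [Finset.sum_comm]
  refine Finset.sum_congr rfl fun i _ => ?_
  rw [Finset.sum_comm]
  refine Finset.sum_congr rfl fun m _ => Finset.sum_congr rfl fun j _ => ?_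
  simp [mul_assoc]

variable {φ}

theorem Q_contr_eq (hc : c.IsClosedForm φ) (k : Fin n) : c.Q φ (contr φ k) = c.Q φ (pp k) := by
  rw [Q_contr, Q_pp]
  have h : (cubic fun i j l => c.d k (φ i j l)) =
      (3 : ℝ) • cubic fun m i j => c.d m (φ i j k) := by
    have e : (fun i j l => c.d k (φ i j l)) = fun i j l => (c.d i (φ j l k) + c.d l (φ i j k))
        + (fun i j l => - c.d i (φ j l k)) j i l := by
      funext i j l
      have := hc i j l k
      linear_combination -this
    set Y : Fin n → Fin n → Fin n → R := fun m i j => c.d m (φ i j k) with hY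
    have e2 : (cubic fun i j l => c.d l (φ i j k)) = cubic Y := by
      have h1 := cubic_swap' (fun i j l => Y l i j)
      have h2 := cubic_swap (fun i l j => Y l i j)
      have h3 : (cubic fun i j l => c.d l (φ i j k)) = cubic fun i j l => Y l i j := rfl
      rw [h3]
      have h4 : cubic (fun i l j => Y l i j) = - cubic Y := cubic_swap Y
      rw [← neg_neg (cubic fun i j l => Y l i j), ← h1, h4, neg_neg]
    have e3 : cubic (fun i j l => (fun i j l => - c.d i (φ j l k)) j i l) = cubic Y := by
      rw [cubic_swap]
      simp [cubic, hY]
    rw [e, cubic_add, cubic_add, e2, e3]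
    rw [show (3 : ℝ) = 1 + 1 + 1 by norm_num, add_smul, add_smul, one_smul]
  rw [h, smul_smul]; norm_num

theorem Q_sq (hc : c.IsClosedForm φ) (x : CAlg R n) : c.Q φ (c.Q φ x) = 0 := by
  induction x using FreeGC.induction with
  | hfn f => exact c.QQ_cf φ f
  | hgen g =>
    rcases g with i | i | i
    · exact c.QQ_xi φ i
    · change c.Q φ (c.Q φ (th i)) = 0
      rw [Q_th, map_sub, c.Q_contr_eq hc, sub_self]
    · change c.Q φ (c.Q φ (pp i)) = 0
      rw [← c.Q_contr_eq hc, QQ_contr]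
  | hadd x y hx hy => rw [map_add, map_add, hx, hy, add_zero]
  | hmul x y hx hy => exact c.QQ_mul φ hx hy

/-! ### Change of coordinates -/

/-- Values of the change of coordinates of `T*[2]T[1]M` induced by a change of coordinates from
`q'` to `q` on `M`:
`ξ'ⁱ = (∂q'ⁱ/∂qʲ) ξʲ`, `θ'ᵢ = (∂qʲ/∂q'ⁱ) θⱼ`,
`p'ᵢ = (∂qʲ/∂q'ⁱ) pⱼ + ∂/∂qᵏ(∂qʲ/∂q'ⁱ) ξᵏ θⱼ`. -/
noncomputable def transGen (c c' : CoordSys R n) : CGen n → CAlg R n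
  | CGen.xi i => ∑ j, cf (c.d j (c'.q i)) * xi j
  | CGen.th i => ∑ j, cf (c'.d i (c.q j)) * th j
  | CGen.p i => (∑ j, cf (c'.d i (c.q j)) * pp j) +
      ∑ j, ∑ k, cf (c.d k (c'.d i (c.q j))) * (xi k * th j)

theorem transGen_mem (c c' : CoordSys R n) (g : CGen n) :
    transGen c c' g ∈ FreeGC.deg R (cw n) (cw n g) := by
  rcases g with i | i | i
  · exact Submodule.sum_mem _ fun j _ => cf_mul_mem _ (xi_mem j)
  · exact Submodule.sum_mem _ fun j _ => cf_mul_mem _ (th_mem j)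
  · refine Submodule.add_mem _ (Submodule.sum_mem _ fun j _ => cf_mul_mem _ (pp_mem j))
      (Submodule.sum_mem _ fun j _ => Submodule.sum_mem _ fun k _ => ?_)
    exact cf_mul_mem _ (xi_th_mem k j)

/-- The change of coordinates: it rewrites a function given in the coordinates `(q', ξ', θ', p')`
in terms of the coordinates `(q, ξ, θ, p)`. -/
noncomputable def trans (c c' : CoordSys R n) : CAlg R n →ₐ[ℝ] CAlg R n :=
  FreeGC.lift (cw n) cf (transGen c c') (fun _ _ => FreeGC.fn_comm _ _)
    (fun g h => FreeGC.comm_of_mem (transGen_mem c c' g) (transGen_mem c c' h))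

/-- The two coordinate systems are related by the chain rule. -/
structure Compat (c c' : CoordSys R n) : Prop where
  left : ∀ i f, c.d i f = ∑ j, c.d i (c'.q j) * c'.d j f
  right : ∀ i f, c'.d i f = ∑ j, c'.d i (c.q j) * c.d j f

theorem Compat.symm {c c' : CoordSys R n} (h : Compat c c') : Compat c' c := ⟨h.right, h.left⟩

section trans

variable {c} {c' : CoordSys R n}

theorem trans_cf (f : R) : trans c c' (cf f) = cf f := FreeGC.lift_fn _ _ _ _ _
theorem trans_xi (i : Fin n) : trans c c' (xi i) = ∑ j, cf (c.d j (c'.q i)) * xi j :=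
  FreeGC.lift_gen _ _ _ _ _
theorem trans_th (i : Fin n) : trans c c' (th i) = ∑ j, cf (c'.d i (c.q j)) * th j :=
  FreeGC.lift_gen _ _ _ _ _
theorem trans_pp (i : Fin n) : trans c c' (pp i) = (∑ j, cf (c'.d i (c.q j)) * pp j) +
      ∑ j, ∑ k, cf (c.d k (c'.d i (c.q j))) * (xi k * th j) :=
  FreeGC.lift_gen _ _ _ _ _

theorem trans_gen_mem (g : CGen n) :
    trans c c' (FreeGC.gen R (cw n) g) ∈ FreeGC.deg R (cw n) (cw n g) := by
  rw [trans, FreeGC.lift_gen]; exact transGen_mem c c' g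

theorem trans_cf_mem (f : R) : trans c c' (cf f) ∈ FreeGC.deg R (cw n) 0 := by
  rw [trans_cf]; exact cf_mem f

theorem trans_mem {k : ℕ} {x : CAlg R n} (hx : x ∈ FreeGC.deg R (cw n) k) :
    trans c c' x ∈ FreeGC.deg R (cw n) k := FreeGC.map_deg _ trans_cf_mem trans_gen_mem hx

/-- `φ'` and `φ` are the components of the same `3`-form. -/
def Tensorial (c c' : CoordSys R n) (φ φ' : Fin n → Fin n → Fin n → R) : Prop :=
  ∀ i j k, φ' i j k =
    ∑ r, ∑ s, ∑ t, c'.d i (c.q r) * (c'.d j (c.q s) * (c'.d k (c.q t) * φ r s t))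

variable {φ' : Fin n → Fin n → Fin n → R}

theorem inv_xi (h : Compat c c') (r : Fin n) :
    ∑ i, cf (c'.d i (c.q r)) * trans c c' (xi i) = xi r := by
  simp only [trans_xi, Finset.mul_sum]
  rw [Finset.sum_comm]
  have : ∀ j, ∑ i, (cf (c'.d i (c.q r)) * (cf (c.d j (c'.q i)) * xi j) : CAlg R n)
      = cf (if j = r then 1 else 0) * xi j := by
    intro j
    rw [← c.d_q, h.left j (c.q r), map_sum, Finset.sum_mul]
    refine Finset.sum_congr rfl fun i _ => ?_
    rw [← mul_assoc, ← map_mul, mul_comm (c'.d i (c.q r))]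
  simp only [this]
  rw [Finset.sum_eq_single r] <;> simp +contextual

theorem sum5 {V : Type*} [AddCommMonoid V] (T : Fin n → Fin n → Fin n → Fin n → Fin n → V) :
    (∑ i, ∑ j, ∑ r, ∑ s, ∑ t, T i j r s t) = ∑ t, ∑ r, ∑ s, ∑ i, ∑ j, T i j r s t := by
  simp only [← Fintype.sum_prod_type']
  exact Fintype.sum_equiv
    ⟨fun x => ⟨x.2.2.2.2, x.2.2.1, x.2.2.2.1, x.1, x.2.1⟩,
      fun x => ⟨x.2.2.2.1, x.2.2.2.2, x.2.1, x.2.2.1, x.1⟩, fun _ => rfl, fun _ => rfl⟩ _ _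
    fun _ => rfl

theorem trans_contr (h : Compat c c') (hφ : Tensorial c c' φ φ') (k : Fin n) :
    trans c c' (contr φ' k) = ∑ t, cf (c'.d k (c.q t)) * contr φ t := by
  obtain ⟨X, hX⟩ : ∃ X : Fin n → CAlg R n, ∀ i, trans c c' (xi i) = X i := ⟨_, fun _ => rfl⟩
  have key : ∀ r s, (xi r * xi s : CAlg R n) = ∑ i, ∑ j, cf (c'.d i (c.q r)) * (cf (c'.d j (c.q s))
      * (X i * X j)) := by
    intro r s
    conv_lhs => rw [← inv_xi h r, ← inv_xi h s, Finset.sum_mul_sum]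
    refine Finset.sum_congr rfl fun i _ => Finset.sum_congr rfl fun j _ => ?_
    rw [hX, hX, mul_assoc, ← mul_assoc (X i), ← FreeGC.fn_comm, mul_assoc]
  simp only [contr, map_smul, mul_smul_comm, ← Finset.smul_sum]
  congr 1
  simp only [map_sum, map_mul, trans_cf, hX]
  simp only [key]
  have e1 : ∀ i j, (cf (φ' i j k) : CAlg R n) = ∑ r, ∑ s, ∑ t,
      cf (c'.d k (c.q t)) * (cf (φ r s t) * (cf (c'.d i (c.q r)) * cf (c'.d j (c.q s)))) := by
    intro i j
    rw [hφ]
    simp only [← map_mul, ← map_sum]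
    congr 1
    refine Finset.sum_congr rfl fun r _ => Finset.sum_congr rfl fun s _ =>
      Finset.sum_congr rfl fun t _ => ?_
    ring
  simp only [e1, Finset.sum_mul, Finset.mul_sum]
  rw [sum5]
  refine Finset.sum_congr rfl fun i _ => Finset.sum_congr rfl fun j _ =>
    Finset.sum_congr rfl fun r _ => Finset.sum_congr rfl fun s _ =>
      Finset.sum_congr rfl fun t _ => ?_
  simp only [mul_assoc]

theorem Q_trans (hc : c.IsClosedForm φ) (hc' : c'.IsClosedForm φ') (h : Compat c c')
    (hφ : Tensorial c c' φ φ') (x : CAlg R n) :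
    c.Q φ (trans c c' x) = trans c c' (c'.Q φ' x) := by
  have hf : ∀ f, c.Q φ (trans c c' (cf f)) = trans c c' (c'.Q φ' (cf f)) := by
    intro f
    rw [trans_cf, Q_cf, Q_cf, map_sum]
    simp only [map_mul, trans_cf, trans_xi, Finset.mul_sum]
    rw [Finset.sum_comm]
    refine Finset.sum_congr rfl fun i _ => ?_
    rw [h.left i f, map_sum, Finset.sum_mul]
    refine Finset.sum_congr rfl fun j _ => ?_
    rw [← mul_assoc, ← map_mul, mul_comm (c.d i (c'.q j))]
  have hxi : ∀ i, c.Q φ (trans c c' (xi i)) = trans c c' (c'.Q φ' (xi i)) := by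
    intro i
    rw [trans_xi, Q_xi, map_zero]
    exact c.Q_dd φ (c'.q i)
  have hmul : ∀ x y, c.Q φ (trans c c' x) = trans c c' (c'.Q φ' x) →
      c.Q φ (trans c c' y) = trans c c' (c'.Q φ' y) →
      c.Q φ (trans c c' (x * y)) = trans c c' (c'.Q φ' (x * y)) := by
    intro x y hx hy
    simp [Q_mul, hx, hy, FreeGC.parity_map (trans c c') trans_cf_mem trans_gen_mem]
  have hcontr : ∀ k, c.Q φ (trans c c' (contr φ' k)) = trans c c' (c'.Q φ' (contr φ' k)) := by
    intro k
    simp only [contr, map_smul, map_sum]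
    congr 1
    refine Finset.sum_congr rfl fun i _ => Finset.sum_congr rfl fun j _ => ?_
    exact hmul _ _ (hf _) (hmul _ _ (hxi i) (hxi j))
  have hth : ∀ i, c.Q φ (trans c c' (th i)) = trans c c' (c'.Q φ' (th i)) := by
    intro i
    rw [Q_th, map_sub, trans_contr h hφ, trans_pp, trans_th, map_sum]
    simp only [Q_cf_mul, Q_th, Finset.sum_add_distrib, mul_sub, Finset.sum_sub_distrib,
      Finset.sum_mul, mul_assoc]
    abel
  refine FreeGC.intertwine (trans c c') trans_cf_mem trans_gen_mem (c'.Q φ') (c.Q φ)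
    (c'.Q_mul φ') (c.Q_mul φ) hf ?_ x
  rintro (i | i | i)
  · exact hxi i
  · exact hth i
  · change c.Q φ (trans c c' (pp i)) = trans c c' (c'.Q φ' (pp i))
    have e : (pp i : CAlg R n) = c'.Q φ' (th i) + contr φ' i := by rw [Q_th]; abel
    rw [← c'.Q_contr_eq hc' i]
    rw [e, map_add, map_add, ← hth, c.Q_sq hc, zero_add, hcontr]

theorem trans_self (x : CAlg R n) : trans c c x = x := by
  have : trans c c = AlgHom.id ℝ (CAlg R n) := by
    refine FreeGC.hom_ext (fun f => trans_cf f) ?_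
    rintro (i | i | i)
    · change trans c c (xi i) = xi i
      rw [trans_xi, Finset.sum_eq_single i] <;> simp +contextual [c.d_q]
    · change trans c c (th i) = th i
      rw [trans_th, Finset.sum_eq_single i] <;> simp +contextual [c.d_q, eq_comm]
    · change trans c c (pp i) = pp i
      have h0 : ∀ k j, c.d k (c.d i (c.q j)) = 0 := by
        intro k j; rw [c.d_q]; split_ifs <;> simp
      rw [trans_pp]
      simp only [h0, map_zero, zero_mul, Finset.sum_const_zero, add_zero]
      rw [Finset.sum_eq_single i] <;> simp +contextual [c.d_q, eq_comm]
  rw [this]; rfl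

theorem trans_trans {c'' : CoordSys R n} (h : Compat c c') (h' : Compat c' c'')
    (h'' : Compat c c'') (x : CAlg R n) : trans c c' (trans c' c'' x) = trans c c'' x := by
  have hz : ∀ c : CoordSys R n, c.IsClosedForm 0 := fun c i j k l => by simp
  have tz : ∀ c c' : CoordSys R n, Tensorial c c' 0 0 := fun c c' i j k => by simp
  have cz : ∀ k, (contr 0 k : CAlg R n) = 0 := fun k => by simp [contr]
  have hxi : ∀ (b : CoordSys R n) i, (xi i : CAlg R n) = b.Q 0 (cf (b.q i)) := by
    intro b i
    rw [Q_cf, Finset.sum_eq_single i] <;> simp +contextual [b.d_q]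
  have hth : ∀ i, trans c c' (trans c' c'' (th i)) = trans c c'' (th i) := by
    intro i
    simp only [trans_th, map_sum, map_mul, trans_cf, Finset.mul_sum]
    rw [Finset.sum_comm]
    refine Finset.sum_congr rfl fun k _ => ?_
    rw [h'.right i (c.q k), map_sum, Finset.sum_mul]
    refine Finset.sum_congr rfl fun j _ => ?_
    rw [← mul_assoc, ← map_mul]
  have : (trans c c').comp (trans c' c'') = trans c c'' := by
    refine FreeGC.hom_ext (fun f => ?_) ?_
    · change trans c c' (trans c' c'' (cf f)) = trans c c'' (cf f)
      simp only [trans_cf]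
    · rintro (i | i | i)
      · change trans c c' (trans c' c'' (xi i)) = trans c c'' (xi i)
        rw [hxi c'' i, ← Q_trans (hz _) (hz _) h' (tz _ _), ← Q_trans (hz _) (hz _) h (tz _ _),
          ← Q_trans (hz _) (hz _) h'' (tz _ _)]
        simp only [trans_cf]
      · exact hth i
      · change trans c c' (trans c' c'' (pp i)) = trans c c'' (pp i)
        have e : (pp i : CAlg R n) = c''.Q 0 (th i) := by rw [Q_th, cz, sub_zero]
        rw [e, ← Q_trans (hz _) (hz _) h' (tz _ _), ← Q_trans (hz _) (hz _) h (tz _ _),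
          ← Q_trans (hz _) (hz _) h'' (tz _ _), hth]
  rw [← this]; rfl

end trans
end CoordSys
end coord
end NQ

namespace NQ

open scoped BigOperators Manifold ContDiff Topology
open TopologicalSpace

section geom

universe u

/-- The model space `ℝⁿ`. -/
abbrev E (n : ℕ) : Type := EuclideanSpace ℝ (Fin n)

/-- The standard basis of `ℝⁿ`. -/
noncomputable def bv {n : ℕ} (i : Fin n) : E n := EuclideanSpace.single i 1

theorem sum_bv {n : ℕ} (v : E n) : v = ∑ i, v i • bv i := by
  ext j
  simp [bv, Finset.sum_apply, Pi.single_apply]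

variable {n : ℕ} {M : Type u} [TopologicalSpace M] [ChartedSpace (E n) M]

/-- The algebra of smooth functions on an open set. -/
abbrev SF (n : ℕ) {M : Type u} [TopologicalSpace M] [ChartedSpace (E n) M] (U : Opens M) : Type u :=
  C^∞⟮𝓡 n, U; 𝓘(ℝ, ℝ), ℝ⟯

/-- Restriction of smooth functions. -/
noncomputable def resF {U V : Opens M} (h : U ≤ V) : SF n V →ₐ[ℝ] SF n U where
  toFun f := ⟨fun x => f (Opens.inclusion h x), f.contMDiff.comp (contMDiff_inclusion h)⟩
  map_one' := rfl
  map_mul' _ _ := rfl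
  map_zero' := rfl
  map_add' _ _ := rfl
  commutes' _ := rfl

theorem resF_apply {U V : Opens M} (h : U ≤ V) (f : SF n V) (x : U) :
    resF h f x = f ⟨x.1, h x.2⟩ := rfl

variable (n M) in
/-- The charts of the maximal smooth atlas. -/
abbrev Chart : Type u :=
  {e : OpenPartialHomeomorph M (E n) // e ∈ IsManifold.maximalAtlas (𝓡 n) ∞ M}

/-- The domain of a chart. -/
def Chart.dom (e : Chart n M) : Opens M := ⟨e.1.source, e.1.open_source⟩

open Classical in
/-- A function on an open subset, read in a chart (and extended by `0`). -/
noncomputable def rd (e : Chart n M) {W : Opens M} (f : W → ℝ) (y : E n) : ℝ :=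
  if h : e.1.symm y ∈ W then f ⟨e.1.symm y, h⟩ else 0

/-- `∂f/∂qⁱ` in the chart `e`. -/
noncomputable def pdFun (e : Chart n M) (i : Fin n) {W : Opens M} (f : W → ℝ) (x : W) : ℝ :=
  fderiv ℝ (rd e f) (e.1 x) (bv i)

section lemmas

variable {W : Opens M} (e : Chart n M)

theorem rd_apply (f : W → ℝ) {x : M} (hx : x ∈ e.dom) (hW : x ∈ W) : rd e f (e.1 x) = f ⟨x, hW⟩ := by
  have h : e.1.symm (e.1 x) = x := e.1.left_inv hx
  have : e.1.symm (e.1 x) ∈ W := by rw [h]; exact hW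
  rw [rd, dif_pos this]
  congr 1
  exact Subtype.ext h

/-- Near a point `e x`, the point `e.symm y` is in any given neighbourhood of `x`. -/
theorem eventually_symm {x : M} (hx : x ∈ e.dom) (hW : x ∈ W) :
    ∀ᶠ y in 𝓝 (e.1 x), y ∈ e.1.target ∧ e.1.symm y ∈ W := by
  have h1 : ∀ᶠ y in 𝓝 (e.1 x), y ∈ e.1.target :=
    e.1.open_target.mem_nhds (e.1.map_source hx)
  have h2 : Filter.Tendsto e.1.symm (𝓝 (e.1 x)) (𝓝 x) := e.1.tendsto_symm hx
  exact h1.and (h2.eventually (W.2.mem_nhds hW))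

theorem rd_eventually (f : W → ℝ) {x : M} (hx : x ∈ e.dom) (hW : x ∈ W) (F : M → ℝ)
    (hF : ∀ z (hz : z ∈ W), z ∈ e.dom → F z = f ⟨z, hz⟩) :
    rd e f =ᶠ[𝓝 (e.1 x)] fun y => F (e.1.symm y) := by
  filter_upwards [eventually_symm e hx hW] with y hy
  rw [rd, dif_pos hy.2, hF _ hy.2 (e.1.map_target hy.1)]

theorem rd_contDiffAt (f : SF n W) {x : M} (hx : x ∈ e.dom) (hW : x ∈ W) :
    ContDiffAt ℝ ∞ (rd e f) (e.1 x) := by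
  classical
  let F : M → ℝ := fun z => if h : z ∈ W then f ⟨z, h⟩ else 0
  have hF : ContMDiffAt (𝓡 n) 𝓘(ℝ, ℝ) ∞ F x := by
    have := (contMDiffAt_subtype_iff (n := ∞) (I := 𝓡 n) (I' := 𝓘(ℝ, ℝ)) (f := F) (x := (⟨x, hW⟩ : W))).1
    apply this
    have e1 : (fun z : W => F z) = f := by
      funext z
      simp [F]
    rw [e1]
    exact f.contMDiff.contMDiffAt
  have h1 : ContMDiffAt (𝓡 n) (𝓡 n) ∞ e.1.symm (e.1 x) :=
    contMDiffAt_symm_of_mem_maximalAtlas e.2 (e.1.map_source hx)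
  have h2 : ContMDiffAt (𝓡 n) 𝓘(ℝ, ℝ) ∞ (F ∘ e.1.symm) (e.1 x) := by
    refine ContMDiffAt.comp (e.1 x) ?_ h1
    rw [e.1.left_inv hx]; exact hF
  exact contMDiffAt_iff_contDiffAt.1 h2

theorem contDiffAt_pd (f : SF n W) {x : M} (hx : x ∈ e.dom) (hW : x ∈ W) (v : E n) :
    ContDiffAt ℝ ∞ (fun y => fderiv ℝ (rd e f) y v) (e.1 x) :=
  ((rd_contDiffAt e f hx hW).fderiv_right (m := ∞) (by simp)).clm_apply contDiffAt_const

/-- A function of the form `x ↦ F (e x)`, with `F` smooth, is smooth. -/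
theorem contMDiff_of_chart (hW : W ≤ e.dom) (F : E n → ℝ)
    (hF : ∀ x ∈ W, ContDiffAt ℝ ∞ F (e.1 x)) :
    ContMDiff (𝓡 n) 𝓘(ℝ, ℝ) ∞ (fun x : W => F (e.1 x)) := by
  intro x
  have h1 : ContMDiffAt (𝓡 n) (𝓡 n) ∞ e.1 (x : M) :=
    contMDiffAt_of_mem_maximalAtlas e.2 (hW x.2)
  have h2 : ContMDiffAt (𝓡 n) 𝓘(ℝ, ℝ) ∞ (F ∘ e.1) (x : M) :=
    ContMDiffAt.comp (x : M) (hF x x.2).contMDiffAt h1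
  exact (contMDiffAt_subtype_iff (f := F ∘ e.1)).2 h2

theorem contMDiff_pd (hW : W ≤ e.dom) (i : Fin n) (f : SF n W) :
    ContMDiff (𝓡 n) 𝓘(ℝ, ℝ) ∞ (pdFun e i f) :=
  contMDiff_of_chart e hW _ fun _ hx => contDiffAt_pd e f (hW hx) hx (bv i)

theorem rd_add (f g : SF n W) {x : M} (hx : x ∈ e.dom) (hW : x ∈ W) :
    rd e (f + g : SF n W) =ᶠ[𝓝 (e.1 x)] fun y => rd e f y + rd e g y := by
  filter_upwards [eventually_symm e hx hW] with y hy
  simp [rd, dif_pos hy.2]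

theorem rd_mul (f g : SF n W) {x : M} (hx : x ∈ e.dom) (hW : x ∈ W) :
    rd e (f * g : SF n W) =ᶠ[𝓝 (e.1 x)] fun y => rd e f y * rd e g y := by
  filter_upwards [eventually_symm e hx hW] with y hy
  simp [rd, dif_pos hy.2]

theorem rd_smul (r : ℝ) (f : SF n W) {x : M} (hx : x ∈ e.dom) (hW : x ∈ W) :
    rd e (r • f : SF n W) =ᶠ[𝓝 (e.1 x)] fun y => r * rd e f y := by
  filter_upwards [eventually_symm e hx hW] with y hy
  simp [rd, dif_pos hy.2]

theorem rd_pd (f : SF n W) (i : Fin n) {x : M} (hx : x ∈ e.dom) (hW : x ∈ W) :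
    rd e (pdFun e i f) =ᶠ[𝓝 (e.1 x)] fun y => fderiv ℝ (rd e f) y (bv i) := by
  filter_upwards [eventually_symm e hx hW] with y hy
  rw [rd, dif_pos hy.2, pdFun]
  simp only [e.1.right_inv hy.1]

theorem rd_diff (hW : W ≤ e.dom) (f : SF n W) (x : W) : DifferentiableAt ℝ (rd e f) (e.1 x) :=
  (rd_contDiffAt e f (hW x.2) x.2).differentiableAt (by simp)

end lemmas

section coordsys

variable {W : Opens M} (e : Chart n M) (hW : W ≤ e.dom)

/-- The derivation `∂/∂qⁱ` of `C^∞(W)`. -/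
noncomputable def pd (i : Fin n) : Derivation ℝ (SF n W) (SF n W) :=
  Derivation.mk'
    { toFun := fun f => ⟨pdFun e i f, contMDiff_pd e hW i f⟩
      map_add' := fun f g => by
        ext x
        change fderiv ℝ (rd e _) (e.1 x) (bv i) = _
        rw [(rd_add e f g (hW x.2) x.2).fderiv_eq, fderiv_fun_add (rd_diff e hW f x) (rd_diff e hW g x)]
        rfl
      map_smul' := fun r f => by
        ext x
        change fderiv ℝ (rd e _) (e.1 x) (bv i) = _
        rw [(rd_smul e r f (hW x.2) x.2).fderiv_eq, fderiv_const_mul (rd_diff e hW f x)]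
        rfl }
    (fun f g => by
      ext x
      change fderiv ℝ (rd e _) (e.1 x) (bv i) = _
      rw [(rd_mul e f g (hW x.2) x.2).fderiv_eq, fderiv_fun_mul (rd_diff e hW f x) (rd_diff e hW g x)]
      rw [rd_apply e f (hW x.2) x.2, rd_apply e g (hW x.2) x.2]
      rfl)

theorem pd_apply (i : Fin n) (f : SF n W) (x : W) :
    pd e hW i f x = fderiv ℝ (rd e f) (e.1 x) (bv i) := rfl

/-- The coordinate function `qⁱ`. -/
noncomputable def qfn (i : Fin n) : SF n W :=
  ⟨fun x => e.1 x i, contMDiff_of_chart e hW (fun y => y i) fun _ _ => by fun_prop⟩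

theorem rd_qfn (i : Fin n) {x : M} (hx : x ∈ e.dom) (hxW : x ∈ W) :
    rd e (qfn e hW i) =ᶠ[𝓝 (e.1 x)] fun y => y i := by
  filter_upwards [eventually_symm e hx hxW] with y hy
  rw [rd, dif_pos hy.2]
  change e.1 (e.1.symm y) i = y i
  rw [e.1.right_inv hy.1]

/-- The coordinate system on `W` given by a chart. -/
noncomputable def coords : CoordSys (SF n W) n where
  q := qfn e hW
  d := pd e hW
  d_comm i j f := by
    ext x
    have key : ∀ i j, pd e hW i (pd e hW j f) x
        = fderiv ℝ (fderiv ℝ (rd e f)) (e.1 x) (bv i) (bv j) := by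
      intro i j
      rw [pd_apply]
      have h := rd_pd e f j (hW x.2) x.2
      rw [show (⇑(pd e hW j f) : W → ℝ) = pdFun e j f from rfl, h.fderiv_eq]
      have hd : DifferentiableAt ℝ (fderiv ℝ (rd e f)) (e.1 x) :=
        ((rd_contDiffAt e f (hW x.2) x.2).fderiv_right (m := ∞) (by simp)).differentiableAt (by simp)
      rw [fderiv_clm_apply hd (differentiableAt_const _)]
      simp
    rw [key, key]
    have hs : IsSymmSndFDerivAt ℝ (rd e f) (e.1 x) :=
      (rd_contDiffAt e f (hW x.2) x.2).isSymmSndFDerivAt (by simp; exact WithTop.coe_le_coe.2 (le_top (a := (2 : ℕ∞))))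
    exact hs _ _
  d_q i j := by
    ext x
    rw [pd_apply, (rd_qfn e hW j (hW x.2) x.2).fderiv_eq]
    have : fderiv ℝ (fun y : E n => y j) (e.1 x) = EuclideanSpace.proj j :=
      (EuclideanSpace.proj j : E n →L[ℝ] ℝ).fderiv
    rw [this]
    by_cases h : i = j
    · subst h; simp [bv]
    · simp [bv, h, Ne.symm h]

end coordsys

section overlap

variable {W : Opens M} (e e' : Chart n M) (hW : W ≤ e.dom) (hW' : W ≤ e'.dom)

/-- The change of charts, from `e` to `e'`. -/
noncomputable def chg (y : E n) : E n := e'.1 (e.1.symm y)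

theorem chg_contDiffAt {x : M} (hx : x ∈ e.dom) (hx' : x ∈ e'.dom) :
    ContDiffAt ℝ ∞ (chg e e') (e.1 x) := by
  have h1 : ContMDiffAt (𝓡 n) (𝓡 n) ∞ e.1.symm (e.1 x) :=
    contMDiffAt_symm_of_mem_maximalAtlas e.2 (e.1.map_source hx)
  have h2 : ContMDiffAt (𝓡 n) (𝓡 n) ∞ (e'.1 ∘ e.1.symm) (e.1 x) := by
    refine ContMDiffAt.comp (e.1 x) ?_ h1
    rw [e.1.left_inv hx]
    exact contMDiffAt_of_mem_maximalAtlas e'.2 hx'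
  exact contMDiffAt_iff_contDiffAt.1 h2

theorem chg_apply {x : M} (hx : x ∈ e.dom) : chg e e' (e.1 x) = e'.1 x := by
  rw [chg, e.1.left_inv hx]

/-- The Jacobian of the change of charts, in terms of coordinate functions. -/
theorem fderiv_chg (x : W) (i : Fin n) :
    fderiv ℝ (chg e e') (e.1 x) (bv i) = ∑ j, (pd e hW i (qfn e' hW' j) x) • bv j := by
  rw [sum_bv (fderiv ℝ (chg e e') (e.1 x) (bv i))]
  refine Finset.sum_congr rfl fun j _ => ?_
  congr 1
  rw [pd_apply]
  have h : rd e (qfn e' hW' j) =ᶠ[𝓝 (e.1 x)] fun y => chg e e' y j := by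
    refine rd_eventually e _ (hW x.2) x.2 (fun z => e'.1 z j) ?_
    intro z hz _
    rfl
  rw [h.fderiv_eq]
  have hd : DifferentiableAt ℝ (chg e e') (e.1 x) :=
    (chg_contDiffAt e e' (hW x.2) (hW' x.2)).differentiableAt (by simp)
  have := ((EuclideanSpace.proj j : E n →L[ℝ] ℝ).hasFDerivAt.comp
    (e.1 (x : M)) hd.hasFDerivAt).fderiv
  change _ = fderiv ℝ ((EuclideanSpace.proj j : E n →L[ℝ] ℝ) ∘ chg e e') (e.1 x) (bv i)
  rw [this]
  rfl

theorem chain (i : Fin n) (f : SF n W) :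
    pd e hW i f = ∑ j, pd e hW i (qfn e' hW' j) * pd e' hW' j f := by
  ext x
  have h : rd e f =ᶠ[𝓝 (e.1 x)] rd e' f ∘ chg e e' := by
    have h1 := eventually_symm (W := W ⊓ e'.dom) e (hW x.2) ⟨x.2, hW' x.2⟩
    filter_upwards [h1] with y hy
    have hyW : e.1.symm y ∈ W := hy.2.1
    rw [Function.comp_apply, chg, rd_apply e' f hy.2.2 hyW, rd, dif_pos hyW]
  have hd : DifferentiableAt ℝ (chg e e') (e.1 x) :=
    (chg_contDiffAt e e' (hW x.2) (hW' x.2)).differentiableAt (by simp)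
  have hf : DifferentiableAt ℝ (rd e' f) (chg e e' (e.1 x)) := by
    rw [chg_apply e e' (hW x.2)]; exact rd_diff e' hW' f x
  rw [pd_apply, h.fderiv_eq, fderiv_comp _ hf hd, ContinuousLinearMap.comp_apply,
    fderiv_chg e e' hW hW', chg_apply e e' (hW x.2), map_sum]
  have : ∀ (s : Finset (Fin n)) (F : Fin n → SF n W), (∑ j ∈ s, F j) x = ∑ j ∈ s, F j x := by
    intro s F
    exact map_sum (ContMDiffMap.evalRingHom (I := 𝓡 n) (n := ∞) x) F s
  rw [this]
  refine Finset.sum_congr rfl fun j _ => ?_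
  rw [map_smul]
  rfl

theorem compat : CoordSys.Compat (coords e hW) (coords e' hW') :=
  ⟨fun i f => chain e e' hW hW' i f, fun i f => chain e' e hW' hW i f⟩

end overlap

section restrict

variable {W V : Opens M} (h : W ≤ V) (e : Chart n M) (hV : V ≤ e.dom)

theorem resF_pd (i : Fin n) (f : SF n V) :
    resF h (pd e hV i f) = pd e (h.trans hV) i (resF h f) := by
  ext x
  rw [resF_apply, pd_apply, pd_apply]
  have : rd e f =ᶠ[𝓝 (e.1 x)] rd e (resF h f) := by
    filter_upwards [eventually_symm e (hV (h x.2)) x.2] with y hy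
    rw [rd, rd, dif_pos hy.2, dif_pos (h hy.2)]
    rfl
  rw [this.fderiv_eq]

theorem resF_qfn (i : Fin n) : resF h (qfn e hV i) = qfn e (h.trans hV) i := rfl

end restrict

end geom
end NQ

namespace NQ

open scoped BigOperators Manifold ContDiff Topology
open TopologicalSpace

section forms

universe u

variable {n : ℕ} {M : Type u} [TopologicalSpace M] [ChartedSpace (E n) M]

/-- The expression of a `k`-form in a chart: its pullback to `ℝⁿ` by the inverse of the chart. -/
noncomputable def formRep {k : ℕ} (H : ∀ x : M, TangentSpace (𝓡 n) x [⋀^Fin k]→L[ℝ] ℝ)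
    (e : Chart n M) (y : E n) : E n [⋀^Fin k]→L[ℝ] ℝ :=
  (H (e.1.symm y)).compContinuousLinearMap (mfderiv (𝓡 n) (𝓡 n) e.1.symm y)

variable (n M) in
/-- Smooth differential `k`-forms on `M`. -/
structure DiffForm (k : ℕ) where
  /-- the value at each point, an alternating form on the tangent space -/
  toFun : ∀ x : M, TangentSpace (𝓡 n) x [⋀^Fin k]→L[ℝ] ℝ
  smooth : ∀ e : Chart n M, ContDiffOn ℝ ∞ (formRep toFun e) e.1.target

namespace DiffForm

/-- A form is closed if its exterior derivative vanishes in every chart. -/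
def IsClosed {k : ℕ} (H : DiffForm n M k) : Prop :=
  ∀ e : Chart n M, ∀ y ∈ e.1.target, extDeriv (formRep H.toFun e) y = 0

noncomputable instance {k : ℕ} : Zero (DiffForm n M k) where
  zero := ⟨fun _ => 0, fun e => by
    have : formRep (fun x : M => (0 : TangentSpace (𝓡 n) x [⋀^Fin k]→L[ℝ] ℝ)) e = fun _ => 0 := by
      funext y
      ext v
      rfl
    rw [this]
    exact contDiffOn_const⟩

theorem formRep_zero {k : ℕ} (e : Chart n M) :
    formRep (0 : DiffForm n M k).toFun e = fun _ => 0 := by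
  funext y
  ext v
  rfl

theorem isClosed_zero {k : ℕ} : (0 : DiffForm n M k).IsClosed := by
  intro e y _
  rw [formRep_zero, extDeriv, fderiv_fun_const]
  ext v
  simp [ContinuousAlternatingMap.alternatizeUncurryFin_apply]

variable (H : DiffForm n M 3)

/-- The components `φᵢⱼₖ = H(∂ᵢ, ∂ⱼ, ∂ₖ)` of a `3`-form in a chart, so that
`H = (1/6) φᵢⱼₖ dqⁱ dqʲ dqᵏ`. -/
noncomputable def comp {W : Opens M} (e : Chart n M) (hW : W ≤ e.dom) (i j k : Fin n) : SF n W :=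
  ⟨fun x => formRep H.toFun e (e.1 x) ![bv i, bv j, bv k],
    contMDiff_of_chart e hW (fun y => formRep H.toFun e y ![bv i, bv j, bv k]) fun x hx => by
      have h := (H.smooth e).contDiffAt (e.1.open_target.mem_nhds (e.1.map_source (hW hx)))
      exact (ContinuousAlternatingMap.apply ℝ (E n) ℝ ![bv i, bv j, bv k]).contDiff.contDiffAt.comp _ h⟩

section

variable {W : Opens M} (e : Chart n M) (hW : W ≤ e.dom)

theorem pd_comp (l i j k : Fin n) (x : W) : pd e hW l (H.comp e hW i j k) x =
    fderiv ℝ (fun y => formRep H.toFun e y ![bv i, bv j, bv k]) (e.1 x) (bv l) := by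
  rw [pd_apply]
  have : rd e (H.comp e hW i j k) =ᶠ[𝓝 (e.1 x)]
      fun y => formRep H.toFun e y ![bv i, bv j, bv k] := by
    filter_upwards [eventually_symm e (hW x.2) x.2] with y hy
    rw [rd, dif_pos hy.2]
    change formRep H.toFun e (e.1 (e.1.symm y)) _ = _
    rw [e.1.right_inv hy.1]
  rw [this.fderiv_eq]

theorem comp_closed (hH : H.IsClosed) : (coords e hW).IsClosedForm (H.comp e hW) := by
  intro i j k l
  ext x
  have ht : e.1 x ∈ e.1.target := e.1.map_source (hW x.2)
  have h := hH e (e.1 x) ht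
  have hd : DifferentiableAt ℝ (formRep H.toFun e) (e.1 x) :=
    ((H.smooth e).contDiffAt (e.1.open_target.mem_nhds ht)).differentiableAt (by simp)
  have h2 := DFunLike.congr_fun h ![bv i, bv j, bv k, bv l]
  rw [extDeriv_apply hd, Fin.sum_univ_four] at h2
  have r0 : (0 : Fin 4).removeNth ![(bv i : E n), bv j, bv k, bv l] = ![bv j, bv k, bv l] := by
    funext m; fin_cases m <;> rfl
  have r1 : (1 : Fin 4).removeNth ![(bv i : E n), bv j, bv k, bv l] = ![bv i, bv k, bv l] := by
    funext m; fin_cases m <;> rfl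
  have r2 : (2 : Fin 4).removeNth ![(bv i : E n), bv j, bv k, bv l] = ![bv i, bv j, bv l] := by
    funext m; fin_cases m <;> rfl
  have r3 : (3 : Fin 4).removeNth ![(bv i : E n), bv j, bv k, bv l] = ![bv i, bv j, bv k] := by
    funext m; fin_cases m <;> rfl
  rw [r0, r1, r2, r3] at h2
  change pd e hW i (H.comp e hW j k l) x - pd e hW j (H.comp e hW i k l) x
    + pd e hW k (H.comp e hW i j l) x - pd e hW l (H.comp e hW i j k) x = 0
  simp only [pd_comp]
  simp at h2
  linarith

end

theorem alt3_expand (η : E n [⋀^Fin 3]→L[ℝ] ℝ) (a b c : Fin n → ℝ) :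
    η ![∑ r, a r • bv r, ∑ s, b s • bv s, ∑ t, c t • bv t] =
      ∑ r, ∑ s, ∑ t, a r * (b s * (c t * η ![bv r, bv s, bv t])) := by
  have h0 : ∀ v w : E n, η ![∑ r, a r • bv r, v, w] = ∑ r, a r * η ![bv r, v, w] := by
    intro v w
    have e : ∀ x : E n, η.toMultilinearMap.toLinearMap ![0, v, w] 0 x = η ![x, v, w] := by
      intro x
      simp only [MultilinearMap.toLinearMap_apply]
      refine congrArg η ?_
      funext m
      fin_cases m <;> simp
    simp only [← e, map_sum, map_smul, smul_eq_mul]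
  have h1 : ∀ u w : E n, η ![u, ∑ r, b r • bv r, w] = ∑ r, b r * η ![u, bv r, w] := by
    intro u w
    have e : ∀ x : E n, η.toMultilinearMap.toLinearMap ![u, 0, w] 1 x = η ![u, x, w] := by
      intro x
      simp only [MultilinearMap.toLinearMap_apply]
      refine congrArg η ?_
      funext m
      fin_cases m <;> simp
    simp only [← e, map_sum, map_smul, smul_eq_mul]
  have h2 : ∀ u v : E n, η ![u, v, ∑ r, c r • bv r] = ∑ r, c r * η ![u, v, bv r] := by
    intro u v
    have e : ∀ x : E n, η.toMultilinearMap.toLinearMap ![u, v, 0] 2 x = η ![u, v, x] := by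
      intro x
      simp only [MultilinearMap.toLinearMap_apply]
      refine congrArg η ?_
      funext m
      fin_cases m <;> simp
    simp only [← e, map_sum, map_smul, smul_eq_mul]
  simp only [h0, h1, h2, Finset.mul_sum]

theorem formRep_change (e e' : Chart n M) {x : M} (hx : x ∈ e.dom) (hx' : x ∈ e'.dom)
    (v : Fin 3 → E n) : formRep H.toFun e' (e'.1 x) v =
      formRep H.toFun e (e.1 x) (fun m => fderiv ℝ (chg e' e) (e'.1 x) (v m)) := by
  have hev : e'.1.symm =ᶠ[𝓝 (e'.1 x)] e.1.symm ∘ chg e' e := by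
    filter_upwards [eventually_symm (W := e.dom) e' hx' hx] with y hy
    rw [Function.comp_apply, chg, e.1.left_inv hy.2]
  have hg : DifferentiableAt ℝ (chg e' e) (e'.1 x) :=
    (chg_contDiffAt e' e hx' hx).differentiableAt (by simp)
  have hs : MDifferentiableAt (𝓡 n) (𝓡 n) e.1.symm (chg e' e (e'.1 x)) := by
    rw [chg_apply e' e hx']
    exact (contMDiffAt_symm_of_mem_maximalAtlas e.2 (e.1.map_source hx)).mdifferentiableAt (by simp)
  have hm : (show E n →L[ℝ] E n from mfderiv (𝓡 n) (𝓡 n) e'.1.symm (e'.1 x)) =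
      (show E n →L[ℝ] E n from mfderiv (𝓡 n) (𝓡 n) e.1.symm (e.1 x)).comp
        (fderiv ℝ (chg e' e) (e'.1 x)) := by
    have h1 : (show E n →L[ℝ] E n from mfderiv (𝓡 n) (𝓡 n) e'.1.symm (e'.1 x)) =
      (show E n →L[ℝ] E n from mfderiv (𝓡 n) (𝓡 n) (e.1.symm ∘ chg e' e) (e'.1 x)) :=
      hev.mfderiv_eq
    rw [h1]
    have h2 := mfderiv_comp (e'.1 x) hs hg.mdifferentiableAt
    rw [mfderiv_eq_fderiv, chg_apply e' e hx'] at h2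
    exact h2
  have hp : e'.1.symm (e'.1 x) = e.1.symm (e.1 x) := by
    rw [e.1.left_inv hx, e'.1.left_inv hx']
  have hL : ∀ m, (show E n →L[ℝ] E n from mfderiv (𝓡 n) (𝓡 n) e'.1.symm (e'.1 x)) (v m) =
      (show E n →L[ℝ] E n from mfderiv (𝓡 n) (𝓡 n) e.1.symm (e.1 x))
        (fderiv ℝ (chg e' e) (e'.1 x) (v m)) := fun m => by rw [hm]; rfl
  change (show E n [⋀^Fin 3]→L[ℝ] ℝ from H.toFun (e'.1.symm (e'.1 x)))
      (fun m => (show E n →L[ℝ] E n from mfderiv (𝓡 n) (𝓡 n) e'.1.symm (e'.1 x)) (v m)) = 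
    (show E n [⋀^Fin 3]→L[ℝ] ℝ from H.toFun (e.1.symm (e.1 x)))
      (fun m => (show E n →L[ℝ] E n from mfderiv (𝓡 n) (𝓡 n) e.1.symm (e.1 x))
        (fderiv ℝ (chg e' e) (e'.1 x) (v m)))
  rw [funext hL]
  rw [hp]

theorem comp_tensorial {W : Opens M} (e e' : Chart n M) (hW : W ≤ e.dom) (hW' : W ≤ e'.dom) :
    CoordSys.Tensorial (coords e hW) (coords e' hW') (H.comp e hW) (H.comp e' hW') := by
  intro i j k
  ext x
  change formRep H.toFun e' (e'.1 x) ![bv i, bv j, bv k] = _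
  rw [formRep_change H e e' (hW x.2) (hW' x.2)]
  have : (fun m => fderiv ℝ (chg e' e) (e'.1 x) ((![bv i, bv j, bv k] : Fin 3 → E n) m)) =
      ![∑ r, (pd e' hW' i (qfn e hW r) x) • bv r, ∑ r, (pd e' hW' j (qfn e hW r) x) • bv r,
        ∑ r, (pd e' hW' k (qfn e hW r) x) • bv r] := by
    funext m
    fin_cases m <;> exact fderiv_chg e' e hW' hW x _
  rw [this, alt3_expand]
  have hs : ∀ (s : Finset (Fin n)) (F : Fin n → SF n W), (∑ j ∈ s, F j) x = ∑ j ∈ s, F j x := by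
    intro s F
    exact map_sum (ContMDiffMap.evalRingHom (I := 𝓡 n) (n := ∞) x) F s
  simp only [hs]
  rfl

theorem resF_comp {W V : Opens M} (h : W ≤ V) (e : Chart n M) (hV : V ≤ e.dom) (i j k : Fin n) :
    resF h (H.comp e hV i j k) = H.comp e (h.trans hV) i j k := rfl

end DiffForm
end forms
end NQ

namespace NQ

open scoped BigOperators Manifold ContDiff Topology TensorProduct
open TopologicalSpace

namespace FreeGC

section glue

universe u v

variable {R : Type u} {G : Type v} [CommRing R] [Algebra ℝ R] {w : G → ℕ}

theorem proj_mem (k : ℕ) (x : FreeGC R w) : proj R w k x ∈ deg R w k := by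
  have hx : x ∈ ⨆ k, deg R w k := by rw [iSup_deg]; trivial
  induction hx using Submodule.iSup_induction' with
  | zero => simp
  | add a b _ _ ha hb => rw [map_add]; exact add_mem ha hb
  | mem j a ha =>
    rw [proj_of_mem ha]
    split_ifs with h
    · subst h; exact ha
    · exact Submodule.zero_mem _

theorem proj_map {S : Type*} [CommRing S] [Algebra ℝ S] (ρ : R →ₐ[ℝ] S) (k : ℕ) (x : FreeGC R w) :
    proj S w k (map w ρ x) = map w ρ (proj R w k x) := by
  have hx : x ∈ ⨆ k, deg R w k := by rw [iSup_deg]; trivial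
  induction hx using Submodule.iSup_induction' with
  | zero => simp
  | add a b _ _ ha hb => simp only [map_add, ha, hb]
  | mem j a ha =>
    rw [proj_of_mem ha, proj_of_mem (map_mem ρ ha)]
    split_ifs <;> simp

variable (R w) in
/-- Constant coefficient elements. -/
noncomputable def base : FreeGC ℝ w →ₐ[ℝ] FreeGC R w := map w (Algebra.ofId ℝ R)

variable (R w) in
/-- The comparison with `R ⊗ FreeGC ℝ w`. -/
noncomputable def toT : FreeGC R w →ₐ[ℝ] R ⊗[ℝ] FreeGC ℝ w :=
  lift w Algebra.TensorProduct.includeLeft (fun g => 1 ⊗ₜ gen ℝ w g)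
    (fun f g => by simp)
    (fun g h => by
      simp only [Algebra.TensorProduct.tmul_mul_tmul, mul_one]
      rw [comm_of_mem (gen_mem (R := ℝ) (w := w) g) (gen_mem h), TensorProduct.tmul_smul])

theorem toT_mul_base (f : R) (m : FreeGC ℝ w) : toT R w (fn w f * base R w m) = f ⊗ₜ m := by
  have h : (toT R w).comp (base R w) = Algebra.TensorProduct.includeRight := by
    refine hom_ext (fun c => ?_) (fun g => ?_)
    · have : fn w c = algebraMap ℝ (FreeGC ℝ w) c := (fn w).commutes c
      rw [this, AlgHom.commutes, AlgHom.commutes]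
    · simp [base, toT]
  rw [map_mul]
  have h' : toT R w (base R w m) = 1 ⊗ₜ m := DFunLike.congr_fun h m
  rw [h', toT, lift_fn]
  simp

variable (R w) in
/-- The coefficients with respect to a basis of `FreeGC ℝ w`. -/
noncomputable def coef (i : Module.Basis.ofVectorSpaceIndex ℝ (FreeGC ℝ w)) : FreeGC R w →ₗ[ℝ] R :=
  ((TensorProduct.rid ℝ R).toLinearMap.comp
    (LinearMap.lTensor R ((Module.Basis.ofVectorSpace ℝ (FreeGC ℝ w)).coord i))).comp
      (toT R w).toLinearMap

theorem coef_mul_base (i) (f : R) (m : FreeGC ℝ w) : coef R w i (fn w f * base R w m) =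
    (Module.Basis.ofVectorSpace ℝ (FreeGC ℝ w)).repr m i • f := by
  simp [coef, toT_mul_base]

theorem coef_map {S : Type*} [CommRing S] [Algebra ℝ S] (ρ : R →ₐ[ℝ] S) (i) (x : FreeGC R w) :
    coef S w i (map w ρ x) = ρ (coef R w i x) := by
  have h : (toT S w).comp (map w ρ) =
      (Algebra.TensorProduct.map ρ (AlgHom.id ℝ (FreeGC ℝ w))).comp (toT R w) := by
    refine hom_ext (fun c => ?_) (fun g => ?_)
    · simp [toT]
    · simp [toT]
  have h' : toT S w (map w ρ x) =
      Algebra.TensorProduct.map ρ (AlgHom.id ℝ (FreeGC ℝ w)) (toT R w x) := DFunLike.congr_fun h x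
  simp only [coef, LinearMap.comp_apply, AlgHom.toLinearMap_apply, h']
  generalize toT R w x = t
  induction t using TensorProduct.induction_on with
  | zero => simp
  | add a b ha hb => simp only [map_add, ha, hb]
  | tmul a b => simp

theorem exists_finset [Finite G] (hw : ∀ g, 1 ≤ w g) (d : ℕ) :
    ∃ I : Finset (Module.Basis.ofVectorSpaceIndex ℝ (FreeGC ℝ w)), ∀ (R : Type u) [CommRing R]
      [Algebra ℝ R], ∀ x ∈ deg R w d,
        x = ∑ i ∈ I, fn w (coef R w i x) *
          base R w (Module.Basis.ofVectorSpace ℝ (FreeGC ℝ w) i) := by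
  classical
  have hfin : Set.Finite {l : List G | (l.map w).sum = d} := by
    refine (List.finite_length_le G d).subset ?_
    intro l hl
    have : l.length ≤ (l.map w).sum := by
      clear hl
      induction l with
      | nil => simp
      | cons a l ih => simp only [List.length_cons, List.map_cons, List.sum_cons]; have := hw a; omega
    exact this.trans (le_of_eq hl)
  set B := Module.Basis.ofVectorSpace ℝ (FreeGC ℝ w) with hB
  refine ⟨hfin.toFinset.biUnion fun l => (B.repr (l.map (gen ℝ w)).prod).support, ?_⟩
  intro R _ _ x hx
  set I := hfin.toFinset.biUnion fun l => (B.repr (l.map (gen ℝ w)).prod).support with hI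
  have key : ∀ (l : List (R ⊕ G)), ∃ (f : R) (l' : List G),
      (l.map (mk w)).prod = fn w f * base R w (l'.map (gen ℝ w)).prod ∧
        (l'.map w).sum = (l.map (genDeg w)).sum := by
    intro l
    induction l with
    | nil => exact ⟨1, [], by simp, by simp⟩
    | cons a l ih =>
      obtain ⟨f, l', h1, h2⟩ := ih
      rcases a with a | a
      · refine ⟨a * f, l', ?_, by simp [h2, genDeg]⟩
        rw [List.map_cons, List.prod_cons, h1, mk_inl, map_mul, mul_assoc]
      · refine ⟨f, a :: l', ?_, by simp [h2, genDeg]⟩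
        rw [List.map_cons, List.prod_cons, h1, mk_inr, List.map_cons, List.prod_cons, map_mul,
          ← mul_assoc, ← fn_comm, mul_assoc]
        simp [base]
  let T : FreeGC R w →ₗ[ℝ] FreeGC R w :=
    ∑ i ∈ I, (LinearMap.mulRight ℝ (base R w (B i))).comp ((fn w).toLinearMap.comp (coef R w i))
  have hT : ∀ y, T y = ∑ i ∈ I, fn w (coef R w i y) * base R w (B i) := by
    intro y
    simp [T]
  have hle : deg R w d ≤ LinearMap.eqLocus LinearMap.id T := by
    refine deg_induction fun l hl => ?_
    obtain ⟨f, l', h1, h2⟩ := key l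
    change _ = T _
    rw [hT, h1]
    change fn w f * _ = _
    simp only [coef_mul_base, map_smul]
    have hsub : (B.repr (l'.map (gen ℝ w)).prod).support ⊆ I := by
      refine Finset.subset_biUnion_of_mem
        (fun l : List G => (B.repr (l.map (gen ℝ w)).prod).support) ?_
      simp [h2, hl]
    have hs : (l'.map (gen ℝ w)).prod = ∑ i ∈ I, B.repr (l'.map (gen ℝ w)).prod i • B i := by
      conv_lhs => rw [← B.linearCombination_repr (l'.map (gen ℝ w)).prod]
      rw [Finsupp.linearCombination_apply, Finsupp.sum_of_support_subset _ hsub _ (by simp)]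
    conv_lhs => rw [hs]
    rw [map_sum, Finset.mul_sum]
    refine Finset.sum_congr rfl fun i _ => ?_
    rw [map_smul, mul_smul_comm, smul_mul_assoc]
  have := hle hx
  rw [← hT]
  exact this

end glue
end FreeGC

section glueSF

universe u

variable {n : ℕ} {M : Type u} [TopologicalSpace M] [ChartedSpace (E n) M]

theorem resF_resF {U V W : Opens M} (h : U ≤ V) (h' : V ≤ W) :
    (resF (n := n) h).comp (resF h') = resF (h.trans h') := rfl

theorem SF_glue {ι : Type*} {V : Opens M} (U : ι → Opens M) (hU : ∀ i, U i ≤ V)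
    (hV : ∀ x ∈ V, ∃ i, x ∈ U i) (f : ∀ i, SF n (U i))
    (hf : ∀ i j (W : Opens M) (hi : W ≤ U i) (hj : W ≤ U j), resF hi (f i) = resF hj (f j)) :
    ∃ F : SF n V, ∀ i, resF (hU i) F = f i := by
  classical
  choose k hk using hV
  have agree : ∀ i (x : M) (hi : x ∈ U i) (hx : x ∈ V),
      f (k x hx) ⟨x, hk x hx⟩ = f i ⟨x, hi⟩ := by
    intro i x hi hx
    have := hf (k x hx) i (U (k x hx) ⊓ U i) inf_le_left inf_le_right
    exact DFunLike.congr_fun this ⟨x, hk x hx, hi⟩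
  let F : V → ℝ := fun x => f (k x x.2) ⟨x, hk x x.2⟩
  have hF : ContMDiff (𝓡 n) 𝓘(ℝ, ℝ) ∞ F := by
    intro x
    let F' : M → ℝ := fun z => if h : z ∈ V then F ⟨z, h⟩ else 0
    have e1 : (fun z : V => F' z) = F := by funext z; simp [F']
    have e2 : (fun z : U (k x x.2) => F' z) = f (k x x.2) := by
      funext z
      simp only [F', dif_pos (hU _ z.2), F]
      exact agree _ z z.2 _
    have h2 : ContMDiffAt (𝓡 n) 𝓘(ℝ, ℝ) ∞ F' (x : M) := by
      refine (contMDiffAt_subtype_iff (U := U (k x x.2)) (f := F') (x := ⟨x, hk x x.2⟩)).1 ?_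
      rw [e2]
      exact (f (k x x.2)).contMDiff.contMDiffAt
    have := (contMDiffAt_subtype_iff (U := V) (f := F') (x := x)).2 h2
    rwa [e1] at this
  refine ⟨⟨F, hF⟩, fun i => ?_⟩
  ext x
  exact agree i x x.2 (hU i x.2)

variable {G : Type} {w : G → ℕ}

theorem FreeGC.sep [Finite G] (hw : ∀ g, 1 ≤ w g) {d : ℕ} {ι : Type*} {V : Opens M}
    (U : ι → Opens M) (hU : ∀ i, U i ≤ V) (hV : ∀ x ∈ V, ∃ i, x ∈ U i)
    {a b : FreeGC (SF n V) w} (ha : a ∈ FreeGC.deg _ w d) (hb : b ∈ FreeGC.deg _ w d)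
    (h : ∀ i, FreeGC.map w (resF (hU i)) a = FreeGC.map w (resF (hU i)) b) : a = b := by
  obtain ⟨I, hI⟩ := FreeGC.exists_finset.{u} hw d
  rw [hI _ a ha, hI _ b hb]
  refine Finset.sum_congr rfl fun i _ => ?_
  congr 2
  ext x
  obtain ⟨j, hj⟩ := hV x x.2
  have := congrArg (FreeGC.coef _ w i) (h j)
  rw [FreeGC.coef_map, FreeGC.coef_map] at this
  exact DFunLike.congr_fun this ⟨x, hj⟩

theorem FreeGC.glue [Finite G] (hw : ∀ g, 1 ≤ w g) {d : ℕ} {ι : Type*} {V : Opens M}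
    (U : ι → Opens M) (hU : ∀ i, U i ≤ V) (hV : ∀ x ∈ V, ∃ i, x ∈ U i)
    (s : ∀ i, FreeGC (SF n (U i)) w) (hs : ∀ i, s i ∈ FreeGC.deg _ w d)
    (h : ∀ i j (W : Opens M) (hi : W ≤ U i) (hj : W ≤ U j),
      FreeGC.map w (resF hi) (s i) = FreeGC.map w (resF hj) (s j)) :
    ∃ a ∈ FreeGC.deg (SF n V) w d, ∀ i, FreeGC.map w (resF (hU i)) a = s i := by
  obtain ⟨I, hI⟩ := FreeGC.exists_finset.{u} hw d
  have : ∀ i, ∃ F : SF n V, ∀ j, resF (hU j) F = FreeGC.coef _ w i (s j) := by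
    intro i
    refine SF_glue U hU hV (fun j => FreeGC.coef _ w i (s j)) ?_
    intro j k W hj hk
    rw [← FreeGC.coef_map, ← FreeGC.coef_map, h j k W hj hk]
  choose F hF using this
  refine ⟨FreeGC.proj _ w d (∑ i ∈ I, FreeGC.fn w (F i) *
    FreeGC.base _ w (Module.Basis.ofVectorSpace ℝ (FreeGC ℝ w) i)), FreeGC.proj_mem _ _, ?_⟩
  intro j
  have e : FreeGC.map w (resF (hU j)) (∑ i ∈ I, FreeGC.fn w (F i) *
      FreeGC.base _ w (Module.Basis.ofVectorSpace ℝ (FreeGC ℝ w) i)) = s j := by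
    conv_rhs => rw [hI _ (s j) (hs j)]
    rw [map_sum]
    refine Finset.sum_congr rfl fun i _ => ?_
    rw [map_mul, FreeGC.map_fn, hF, FreeGC.base, FreeGC.map_map, FreeGC.base]
    congr 2
  rw [← FreeGC.proj_map, e, FreeGC.proj_of_mem (hs j), if_pos rfl]

end glueSF
end NQ

namespace NQ

open scoped BigOperators Manifold ContDiff Topology
open TopologicalSpace

namespace CoordSys

universe u

variable {R S : Type u} [CommRing R] [Algebra ℝ R] [CommRing S] [Algebra ℝ S] {n : ℕ}

/-- `d` is the restriction of the coordinate system `c` along `ρ`. -/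
structure Over (ρ : R →ₐ[ℝ] S) (c : CoordSys R n) (d : CoordSys S n) : Prop where
  hq : ∀ i, ρ (c.q i) = d.q i
  hd : ∀ i f, ρ (c.d i f) = d.d i (ρ f)

variable {ρ : R →ₐ[ℝ] S} {c c' : CoordSys R n} {d d' : CoordSys S n}

theorem map_xi (i : Fin n) : FreeGC.map (cw n) ρ (xi i) = xi i := FreeGC.map_gen _ _
theorem map_th (i : Fin n) : FreeGC.map (cw n) ρ (th i) = th i := FreeGC.map_gen _ _
theorem map_pp (i : Fin n) : FreeGC.map (cw n) ρ (pp i) = pp i := FreeGC.map_gen _ _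

theorem map_trans (h : Over ρ c d) (h' : Over ρ c' d') (x : CAlg R n) :
    FreeGC.map (cw n) ρ (trans c c' x) = trans d d' (FreeGC.map (cw n) ρ x) := by
  have : (FreeGC.map (cw n) ρ).comp (trans c c') = (trans d d').comp (FreeGC.map (cw n) ρ) := by
    refine FreeGC.hom_ext (fun f => ?_) ?_
    · simp only [AlgHom.comp_apply]
      rw [trans_cf, FreeGC.map_fn, trans_cf]
    · rintro (i | i | i)
      · change FreeGC.map (cw n) ρ (trans c c' (xi i)) = trans d d' (FreeGC.map (cw n) ρ (xi i))
        rw [map_xi, trans_xi, trans_xi]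
        simp [map_xi, h.hd, h'.hq]
      · change FreeGC.map (cw n) ρ (trans c c' (th i)) = trans d d' (FreeGC.map (cw n) ρ (th i))
        rw [map_th, trans_th, trans_th]
        simp [map_th, h.hq, h'.hd]
      · change FreeGC.map (cw n) ρ (trans c c' (pp i)) = trans d d' (FreeGC.map (cw n) ρ (pp i))
        rw [map_pp, trans_pp, trans_pp]
        simp [map_pp, map_xi, map_th, h.hq, h'.hd, h.hd]
  exact DFunLike.congr_fun this x

theorem map_contr (φ : Fin n → Fin n → Fin n → R) (k : Fin n) :
    FreeGC.map (cw n) ρ (contr φ k) = contr (fun i j k => ρ (φ i j k)) k := by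
  simp [contr, map_xi]

theorem map_cubic (φ : Fin n → Fin n → Fin n → R) :
    FreeGC.map (cw n) ρ (cubic φ) = cubic (fun i j k => ρ (φ i j k)) := by
  simp [cubic, map_xi]

theorem map_Q (h : Over ρ c d) (φ : Fin n → Fin n → Fin n → R) (x : CAlg R n) :
    FreeGC.map (cw n) ρ (c.Q φ x) = d.Q (fun i j k => ρ (φ i j k)) (FreeGC.map (cw n) ρ x) := by
  refine (FreeGC.intertwine (FreeGC.map (cw n) ρ) (fun f => ?_) (fun g => ?_) (c.Q φ)
    (d.Q fun i j k => ρ (φ i j k)) (c.Q_mul φ) (d.Q_mul _) (fun f => ?_) ?_ x).symm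
  · rw [FreeGC.map_fn]; exact FreeGC.fn_mem _
  · rw [FreeGC.map_gen]; exact FreeGC.gen_mem g
  · rw [FreeGC.map_fn, Q_cf, Q_cf]
    simp [map_xi, h.hd]
  · rintro (i | i | i)
    · change d.Q _ (FreeGC.map (cw n) ρ (xi i)) = FreeGC.map (cw n) ρ (c.Q φ (xi i))
      rw [map_xi, Q_xi, Q_xi, map_zero]
    · change d.Q _ (FreeGC.map (cw n) ρ (th i)) = FreeGC.map (cw n) ρ (c.Q φ (th i))
      rw [map_th, Q_th, Q_th, map_sub, map_pp, map_contr]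
    · change d.Q _ (FreeGC.map (cw n) ρ (pp i)) = FreeGC.map (cw n) ρ (c.Q φ (pp i))
      rw [map_pp, Q_pp, Q_pp, map_smul, map_cubic]
      simp only [h.hd]

end CoordSys

universe u

variable {n : ℕ} {M : Type u} [TopologicalSpace M] [ChartedSpace (E n) M]

theorem coords_over {W V : Opens M} (h : W ≤ V) (e : Chart n M) (hV : V ≤ e.dom) :
    CoordSys.Over (resF h) (coords e hV) (coords e (h.trans hV)) :=
  ⟨fun _ => rfl, fun i f => resF_pd h e hV i f⟩

/-- An NQ manifold of degree (at most) `k` with body the `n`-dimensional manifold `M`, given by its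
sheaf of graded commutative algebras of functions `U ↦ Fn U = ⨁ᵈ deg U d`, locally freely generated
over the smooth functions of the body by finitely many coordinates of degrees `1, …, k`, and by its
homological vector field `Q`. An NQ manifold of degree `k` is a Lie `k`-algebroid. -/
structure NQManifold (k n : ℕ) (M : Type u) [TopologicalSpace M] [ChartedSpace (E n) M] where
  /-- functions over an open subset of the body -/
  Fn : Opens M → Type u
  [ring : ∀ U, Ring (Fn U)]
  [algebra : ∀ U, Algebra ℝ (Fn U)]
  /-- functions of degree `d` -/
  deg : ∀ U, ℕ → Submodule ℝ (Fn U)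
  /-- restriction of functions -/
  res : ∀ {U V : Opens M}, U ≤ V → Fn V →ₐ[ℝ] Fn U
  /-- functions on the body -/
  ofFn : ∀ U, SF n U →ₐ[ℝ] Fn U
  /-- the homological vector field -/
  Q : ∀ U, Fn U →ₗ[ℝ] Fn U
  isInternal : ∀ U, DirectSum.IsInternal (deg U)
  mul_mem : ∀ U i j (x y : Fn U), x ∈ deg U i → y ∈ deg U j → x * y ∈ deg U (i + j)
  comm : ∀ U i j (x y : Fn U), x ∈ deg U i → y ∈ deg U j → x * y = (-1 : ℝ) ^ (i * j) • (y * x)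
  ofFn_mem : ∀ U (f : SF n U), ofFn U f ∈ deg U 0
  res_refl : ∀ U (x : Fn U), res le_rfl x = x
  res_res : ∀ {U V W : Opens M} (h : U ≤ V) (h' : V ≤ W) (x : Fn W),
    res h (res h' x) = res (h.trans h') x
  res_mem : ∀ {U V : Opens M} (h : U ≤ V) (d : ℕ) (x : Fn V), x ∈ deg V d → res h x ∈ deg U d
  res_ofFn : ∀ {U V : Opens M} (h : U ≤ V) (f : SF n V), res h (ofFn V f) = ofFn U (resF h f)
  sheaf : ∀ {ι : Type u} (U : ι → Opens M) (V : Opens M) (hU : ∀ i, U i ≤ V),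
    (∀ x ∈ V, ∃ i, x ∈ U i) → ∀ (d : ℕ) (s : ∀ i, Fn (U i)), (∀ i, s i ∈ deg (U i) d) →
    (∀ i j, res (inf_le_left : U i ⊓ U j ≤ U i) (s i) = res inf_le_right (s j)) →
    ∃! a : Fn V, a ∈ deg V d ∧ ∀ i, res (hU i) a = s i
  locally_free : ∀ x : M, ∃ W : Opens M, x ∈ W ∧ ∃ (G : Type) (_ : Finite G) (w : G → ℕ),
    (∀ g, 1 ≤ w g ∧ w g ≤ k) ∧ ∃ γ : G → Fn W, (∀ g, γ g ∈ deg W (w g)) ∧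
      ∀ (W' : Opens M) (h : W' ≤ W), ∃ Θ : FreeGC (SF n W') w ≃ₐ[ℝ] Fn W',
        (∀ f, Θ (FreeGC.fn w f) = ofFn W' f) ∧ ∀ g, Θ (FreeGC.gen _ w g) = res h (γ g)
  Q_mem : ∀ U d (x : Fn U), x ∈ deg U d → Q U x ∈ deg U (d + 1)
  Q_mul : ∀ U d (x y : Fn U), x ∈ deg U d → Q U (x * y) = Q U x * y + (-1 : ℝ) ^ d • (x * Q U y)
  Q_sq : ∀ U (x : Fn U), Q U (Q U x) = 0
  res_Q : ∀ {U V : Opens M} (h : U ≤ V) (x : Fn V), res h (Q V x) = Q U (res h x)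

attribute [instance] NQManifold.ring NQManifold.algebra

/-- An isomorphism of NQ manifolds `X → Y`: a diffeomorphism of the bodies together with pullback
isomorphisms of the graded algebras of functions, compatible with restrictions and with the
functions of the body, and intertwining the homological vector fields. -/
structure NQManifold.Iso {k n : ℕ} {M M' : Type u} [TopologicalSpace M] [ChartedSpace (E n) M]
    [TopologicalSpace M'] [ChartedSpace (E n) M'] (X : NQManifold k n M) (Y : NQManifold k n M') where
  base : Diffeomorph (𝓡 n) (𝓡 n) M M' ∞
  pull : ∀ V : Opens M', Y.Fn V ≃ₐ[ℝ] X.Fn (Opens.comap ⟨base, base.continuous⟩ V)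
  pull_mem : ∀ V d (y : Y.Fn V), y ∈ Y.deg V d ↔ pull V y ∈ X.deg _ d
  pull_res : ∀ {V V' : Opens M'} (h : V ≤ V') (y : Y.Fn V'),
    pull V (Y.res h y) = X.res (Opens.comap_mono _ h) (pull V' y)
  pull_ofFn : ∀ V (f : SF n V) (g : SF n (Opens.comap ⟨base, base.continuous⟩ V)),
    (∀ x, g x = f ⟨base x, x.2⟩) → pull V (Y.ofFn V f) = X.ofFn _ g
  pull_Q : ∀ V (y : Y.Fn V), pull V (Y.Q V y) = X.Q _ (pull V y)

/-! ### The NQ manifold `T*[2]T[1]M` -/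

/-- Families of local functions on `T*[2]T[1]M` over `U`, one for each chart of `M`. -/
abbrev Fam (n : ℕ) {M : Type u} [TopologicalSpace M] [ChartedSpace (E n) M] (U : Opens M) : Type u :=
  ∀ e : Chart n M, CAlg (SF n (U ⊓ e.dom)) n

/-- The local functions `F e` agree after change of coordinates. -/
def IsCompat {U : Opens M} (F : Fam n U) : Prop :=
  ∀ (e e' : Chart n M) (W : Opens M) (hU : W ≤ U) (h : W ≤ e.dom) (h' : W ≤ e'.dom),
    FreeGC.map (cw n) (resF (le_inf hU h)) (F e) =
      CoordSys.trans (coords e h) (coords e' h') (FreeGC.map (cw n) (resF (le_inf hU h')) (F e'))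

/-- The functions of degree `d` on `T*[2]T[1]M` over `U`. -/
noncomputable def piece (n : ℕ) {M : Type u} [TopologicalSpace M] [ChartedSpace (E n) M]
    (U : Opens M) (d : ℕ) : Submodule ℝ (Fam n U) where
  carrier := {F | (∀ e, F e ∈ FreeGC.deg _ (cw n) d) ∧ IsCompat F}
  add_mem' := by
    rintro F F' ⟨h1, h2⟩ ⟨h1', h2'⟩
    refine ⟨fun e => add_mem (h1 e) (h1' e), fun e e' W hU h h' => ?_⟩
    simp only [Pi.add_apply, map_add, h2 e e' W hU h h', h2' e e' W hU h h']
  zero_mem' := ⟨fun e => zero_mem _, fun e e' W hU h h' => by simp⟩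
  smul_mem' := by
    rintro r F ⟨h1, h2⟩
    refine ⟨fun e => Submodule.smul_mem _ _ (h1 e), fun e e' W hU h h' => ?_⟩
    simp only [Pi.smul_apply, map_smul, h2 e e' W hU h h']

theorem piece_mul {U : Opens M} {i j : ℕ} {F F' : Fam n U} (hF : F ∈ piece n U i)
    (hF' : F' ∈ piece n U j) : F * F' ∈ piece n U (i + j) := by
  refine ⟨fun e => FreeGC.mul_mem (hF.1 e) (hF'.1 e), fun e e' W hU h h' => ?_⟩
  simp only [Pi.mul_apply, map_mul, hF.2 e e' W hU h h', hF'.2 e e' W hU h h']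

/-- The algebra of functions on `T*[2]T[1]M` over `U`: sums of homogeneous functions. -/
noncomputable def fnAlg (n : ℕ) {M : Type u} [TopologicalSpace M] [ChartedSpace (E n) M]
    (U : Opens M) : Subalgebra ℝ (Fam n U) where
  __ := (⨆ d, piece n U d : Submodule ℝ (Fam n U))
  mul_mem' := by
    intro a b (ha : a ∈ ⨆ d, piece n U d) (hb : b ∈ ⨆ d, piece n U d)
    change a * b ∈ ⨆ d, piece n U d
    induction ha using Submodule.iSup_induction' with
    | zero => simp
    | add x y _ _ hx hy => rw [add_mul]; exact add_mem hx hy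
    | mem i x hx =>
      induction hb using Submodule.iSup_induction' with
      | zero => simp
      | add y z _ _ hy hz => rw [mul_add]; exact add_mem hy hz
      | mem j y hy => exact Submodule.mem_iSup_of_mem _ (piece_mul hx hy)
  algebraMap_mem' := by
    intro r
    refine Submodule.mem_iSup_of_mem 0 ⟨fun e => ?_, fun e e' W hU h h' => ?_⟩
    · rw [Pi.algebraMap_apply, ← (FreeGC.fn (cw n)).commutes]
      exact FreeGC.fn_mem _
    · simp only [Pi.algebraMap_apply, AlgHom.commutes]

theorem mem_fnAlg {U : Opens M} {d : ℕ} {F : Fam n U} (h : F ∈ piece n U d) : F ∈ fnAlg n U :=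
  Submodule.mem_iSup_of_mem d h

/-- Homogeneous parts of families. -/
noncomputable def famProj (U : Opens M) (k : ℕ) : Fam n U →ₗ[ℝ] Fam n U :=
  LinearMap.pi fun e => (FreeGC.proj (SF n (U ⊓ e.dom)) (cw n) k).comp
    (LinearMap.proj (φ := fun e : Chart n M => CAlg (SF n (U ⊓ e.dom)) n) e)

/-- A map of families that sends homogeneous functions to functions sends functions to functions. -/
theorem fnAlg_le {U V : Opens M} (T : Fam n V →ₗ[ℝ] Fam n U)
    (h : ∀ d, ∀ F ∈ piece n V d, T F ∈ fnAlg n U) {F : Fam n V} (hF : F ∈ fnAlg n V) :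
    T F ∈ fnAlg n U := by
  have : (⨆ d, piece n V d) ≤ (Subalgebra.toSubmodule (fnAlg n U)).comap T := iSup_le h
  exact this hF

/-- Restriction of families. -/
noncomputable def famRes {U V : Opens M} (h : U ≤ V) : Fam n V →ₐ[ℝ] Fam n U :=
  AlgHom.pi fun e => (FreeGC.map (cw n) (resF (inf_le_inf_right e.dom h))).comp
    (Pi.evalAlgHom ℝ _ e)

theorem famRes_apply {U V : Opens M} (h : U ≤ V) (F : Fam n V) (e : Chart n M) :
    famRes h F e = FreeGC.map (cw n) (resF (inf_le_inf_right e.dom h)) (F e) := rfl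

theorem famRes_mem {U V : Opens M} (h : U ≤ V) {d : ℕ} {F : Fam n V} (hF : F ∈ piece n V d) :
    famRes h F ∈ piece n U d := by
  refine ⟨fun e => FreeGC.map_mem _ (hF.1 e), fun e e' W hU he he' => ?_⟩
  simp only [famRes_apply, FreeGC.map_map, resF_resF]
  exact hF.2 e e' W (hU.trans h) he he'

/-- Functions on `M`, as functions on `T*[2]T[1]M`. -/
noncomputable def famOf (U : Opens M) : SF n U →ₐ[ℝ] Fam n U :=
  AlgHom.pi fun _ => cf.comp (resF inf_le_left)

theorem famOf_mem (U : Opens M) (f : SF n U) : famOf U f ∈ piece n U 0 := by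
  refine ⟨fun e => FreeGC.fn_mem _, fun e e' W hU h h' => ?_⟩
  change FreeGC.map (cw n) _ (FreeGC.fn (cw n) _) =
    CoordSys.trans _ _ (FreeGC.map (cw n) _ (FreeGC.fn (cw n) _))
  rw [FreeGC.map_fn, FreeGC.map_fn, CoordSys.trans_cf]
  rfl

/-- The vector field of the `3`-form `H`, in each chart
`Q = ξⁱ ∂/∂qⁱ + pᵢ ∂/∂θᵢ + (1/6) (∂φᵢⱼₖ/∂qˡ) ξⁱξʲξᵏ ∂/∂pₗ - (1/2) φᵢⱼₖ ξⁱξʲ ∂/∂θₖ`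
with `H = (1/6) φᵢⱼₖ dqⁱ dqʲ dqᵏ`. -/
noncomputable def famQ (H : DiffForm n M 3) (U : Opens M) : Fam n U →ₗ[ℝ] Fam n U :=
  LinearMap.pi fun e =>
    ((coords e inf_le_right).Q (H.comp e inf_le_right)).comp (LinearMap.proj e)

theorem famQ_apply (H : DiffForm n M 3) (U : Opens M) (F : Fam n U) (e : Chart n M) :
    famQ H U F e = (coords e inf_le_right).Q (H.comp e inf_le_right) (F e) := rfl

theorem famQ_mem {H : DiffForm n M 3} (hH : H.IsClosed) {U : Opens M} {d : ℕ} {F : Fam n U}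
    (hF : F ∈ piece n U d) : famQ H U F ∈ piece n U (d + 1) := by
  refine ⟨fun e => CoordSys.Q_mem _ _ (hF.1 e), fun e e' W hU h h' => ?_⟩
  rw [famQ_apply, famQ_apply, CoordSys.map_Q (coords_over _ e _), CoordSys.map_Q (coords_over _ e' _),
    hF.2 e e' W hU h h']
  exact CoordSys.Q_trans (H.comp_closed e h hH) (H.comp_closed e' h' hH) (compat e e' h h')
    (H.comp_tensorial e e' h h') _

theorem famQ_res (H : DiffForm n M 3) {U V : Opens M} (h : U ≤ V) (F : Fam n V) :
    famRes h (famQ H V F) = famQ H U (famRes h F) := by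
  funext e
  exact CoordSys.map_Q (coords_over _ e _) _ _

theorem famQ_mul (H : DiffForm n M 3) {U : Opens M} {d : ℕ} {F : Fam n U} (F' : Fam n U)
    (hF : F ∈ piece n U d) :
    famQ H U (F * F') = famQ H U F * F' + (-1 : ℝ) ^ d • (F * famQ H U F') := by
  funext e
  rw [Pi.add_apply, Pi.smul_apply, Pi.mul_apply, Pi.mul_apply, famQ_apply, famQ_apply, famQ_apply,
    Pi.mul_apply, CoordSys.Q_mul, FreeGC.parity_of_mem (hF.1 e), smul_mul_assoc]

theorem famQ_sq {H : DiffForm n M 3} (hH : H.IsClosed) {U : Opens M} (F : Fam n U) :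
    famQ H U (famQ H U F) = 0 := by
  funext e
  exact CoordSys.Q_sq _ (H.comp_closed e inf_le_right hH) _

/-- The function over `U ≤ e.dom` given by a local expression in the chart `e`. -/
noncomputable def famLoc (e : Chart n M) {U : Opens M} (hU : U ≤ e.dom) :
    CAlg (SF n U) n →ₐ[ℝ] Fam n U :=
  AlgHom.pi fun e' =>
    (CoordSys.trans (coords e' (inf_le_right : U ⊓ e'.dom ≤ e'.dom))
      (coords e (inf_le_left.trans hU))).comp (FreeGC.map (cw n) (resF inf_le_left))

theorem famLoc_apply (e : Chart n M) {U : Opens M} (hU : U ≤ e.dom) (a : CAlg (SF n U) n)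
    (e' : Chart n M) : famLoc e hU a e' =
      CoordSys.trans (coords e' (inf_le_right : U ⊓ e'.dom ≤ e'.dom))
        (coords e (inf_le_left.trans hU)) (FreeGC.map (cw n) (resF inf_le_left) a) := rfl

theorem map_famLoc (e : Chart n M) {U : Opens M} (hU : U ≤ e.dom) (a : CAlg (SF n U) n)
    (e' : Chart n M) {W : Opens M} (hW : W ≤ U) (h' : W ≤ e'.dom) :
    FreeGC.map (cw n) (resF (le_inf hW h')) (famLoc e hU a e') =
      CoordSys.trans (coords e' h') (coords e (hW.trans hU)) (FreeGC.map (cw n) (resF hW) a) := by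
  rw [famLoc_apply, CoordSys.map_trans (coords_over _ e' _) (coords_over _ e _), FreeGC.map_map,
    resF_resF]

theorem famLoc_mem (e : Chart n M) {U : Opens M} (hU : U ≤ e.dom) {d : ℕ} {a : CAlg (SF n U) n}
    (ha : a ∈ FreeGC.deg _ (cw n) d) : famLoc e hU a ∈ piece n U d := by
  refine ⟨fun e' => CoordSys.trans_mem (FreeGC.map_mem _ ha), fun e1 e2 W hW h h' => ?_⟩
  rw [map_famLoc e hU a e1 hW h, map_famLoc e hU a e2 hW h',
    CoordSys.trans_trans (compat e1 e2 h h') (compat e2 e h' (hW.trans hU))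
      (compat e1 e h (hW.trans hU))]

theorem famLoc_left (e : Chart n M) {U : Opens M} (hU : U ≤ e.dom) (a : CAlg (SF n U) n) :
    FreeGC.map (cw n) (resF (le_inf le_rfl hU)) (famLoc e hU a e) = a := by
  rw [map_famLoc e hU a e le_rfl hU, CoordSys.trans_self]
  exact FreeGC.map_id a

theorem famLoc_right (e : Chart n M) {U : Opens M} (hU : U ≤ e.dom) {F : Fam n U}
    (hF : F ∈ fnAlg n U) :
    famLoc e hU (FreeGC.map (cw n) (resF (le_inf le_rfl hU)) (F e)) = F := by
  have hF' : F ∈ ⨆ d, piece n U d := hF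
  induction hF' using Submodule.iSup_induction' with
  | zero => simp
  | add x y hx hy hx' hy' =>
    rw [Pi.add_apply, map_add, map_add, hx' hx, hy' hy]
  | mem i x hx =>
    funext e'
    rw [famLoc_apply, FreeGC.map_map, resF_resF]
    have := hx.2 e' e (U ⊓ e'.dom) inf_le_left inf_le_right (inf_le_left.trans hU)
    rw [← this]
    exact FreeGC.map_id _

theorem cw_pos (g : CGen n) : 1 ≤ cw n g ∧ cw n g ≤ 2 := by
  rcases g with i | i | i <;> simp [cw]

instance : Finite (CGen n) :=
  Finite.of_injective (β := Fin n ⊕ Fin n ⊕ Fin n)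
    (fun | CGen.xi i => Sum.inl i | CGen.th i => Sum.inr (Sum.inl i) | CGen.p i => Sum.inr (Sum.inr i))
    (by rintro (i | i | i) (j | j | j) <;> simp)

/-- The NQ manifold `T*[2]T[1]M` with the homological vector field of the closed `3`-form `H`:
the exact Courant algebroid with Ševera class `[H]`. For `H = 0` it is the standard Courant
algebroid. -/
noncomputable def exactCourant [IsManifold (𝓡 n) ∞ M] (H : DiffForm n M 3) (hH : H.IsClosed) :
    NQManifold 2 n M where
  Fn U := fnAlg n U
  deg U d := (piece n U d).comap (fnAlg n U).val.toLinearMap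
  res {U V} h := ((famRes h).comp (fnAlg n V).val).codRestrict (fnAlg n U) fun x =>
    fnAlg_le (famRes h).toLinearMap (fun _ _ hF => mem_fnAlg (famRes_mem h hF)) x.2
  ofFn U := (famOf U).codRestrict (fnAlg n U) fun f => mem_fnAlg (famOf_mem U f)
  Q U := ((famQ H U).comp (fnAlg n U).val.toLinearMap).codRestrict
    (Subalgebra.toSubmodule (fnAlg n U)) fun x =>
      fnAlg_le (famQ H U) (fun _ _ hF => mem_fnAlg (famQ_mem hH hF)) x.2
  isInternal U := by
    refine DirectSum.isInternal_submodule_of_iSupIndep_of_iSup_eq_top ?_ ?_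
    · refine iSupIndep_of_proj _ (fnAlg n U).val.toLinearMap Subtype.val_injective
        (fun k => (famProj U k).comp (fnAlg n U).val.toLinearMap) ?_
      intro i j x hx
      funext e
      have := FreeGC.proj_of_mem (k := j) (hx.1 e)
      refine this.trans ?_
      split_ifs <;> rfl
    · rw [eq_top_iff]
      rintro ⟨x, hx⟩ -
      have hx' : x ∈ ⨆ d, piece n U d := hx
      induction hx' using Submodule.iSup_induction' with
      | zero => exact zero_mem _
      | add a b ha hb ha' hb' => exact add_mem (ha' ha) (hb' hb)
      | mem i a ha => exact Submodule.mem_iSup_of_mem i (show a ∈ piece n U i from ha)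
  mul_mem U i j x y hx hy := piece_mul (n := n) hx hy
  comm U i j x y hx hy := Subtype.ext (funext fun e => FreeGC.comm_of_mem (hx.1 e) (hy.1 e))
  ofFn_mem U f := famOf_mem U f
  res_refl U x := Subtype.ext (funext fun e => FreeGC.map_id _)
  res_res h h' x := Subtype.ext (funext fun e => FreeGC.map_map _ _ _)
  res_mem h d x hx := famRes_mem h hx
  res_ofFn h f := Subtype.ext (funext fun e => FreeGC.map_fn _ _)
  sheaf {ι} U V hU hV d s hs hc := by
    have hw : ∀ g : CGen n, 1 ≤ cw n g := fun g => (cw_pos g).1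
    have hc' : ∀ (e : Chart n M) i j (W : Opens M) (hi : W ≤ U i ⊓ e.dom) (hj : W ≤ U j ⊓ e.dom),
        FreeGC.map (cw n) (resF hi) ((s i).1 e) = FreeGC.map (cw n) (resF hj) ((s j).1 e) := by
      intro e i j W hi hj
      have h1 := congrFun (congrArg Subtype.val (hc i j)) e
      have h2 := congrArg (FreeGC.map (cw n) (resF
        (le_inf (le_inf (hi.trans inf_le_left) (hj.trans inf_le_left)) (hi.trans inf_le_right) :
          W ≤ (U i ⊓ U j) ⊓ e.dom))) h1
      change FreeGC.map (cw n) _ (FreeGC.map (cw n) _ _) =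
        FreeGC.map (cw n) _ (FreeGC.map (cw n) _ _) at h2
      rw [FreeGC.map_map, FreeGC.map_map] at h2
      exact h2
    have hg : ∀ e : Chart n M, ∃ a ∈ FreeGC.deg (SF n (V ⊓ e.dom)) (cw n) d,
        ∀ i, FreeGC.map (cw n) (resF (inf_le_inf_right e.dom (hU i))) a = (s i).1 e := by
      intro e
      refine FreeGC.glue hw (fun i => U i ⊓ e.dom) (fun i => inf_le_inf_right e.dom (hU i)) ?_
        (fun i => (s i).1 e) (fun i => (hs i).1 e) (hc' e)
      intro x hx
      obtain ⟨i, hi⟩ := hV x hx.1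
      exact ⟨i, hi, hx.2⟩
    choose a ha1 ha2 using hg
    have hap : a ∈ piece n V d := by
      refine ⟨ha1, fun e e' W hW h h' => ?_⟩
      refine FreeGC.sep hw (d := d) (fun i => W ⊓ U i) (fun i => inf_le_left) ?_
        (FreeGC.map_mem _ (ha1 e)) (CoordSys.trans_mem (FreeGC.map_mem _ (ha1 e'))) ?_
      · intro x hx
        obtain ⟨i, hi⟩ := hV x (hW hx)
        exact ⟨i, hx, hi⟩
      · intro i
        have h3 := (hs i).2 e e' (W ⊓ U i) inf_le_right (inf_le_left.trans h) (inf_le_left.trans h')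
        change FreeGC.map (cw n) _ ((s i).1 e) =
          CoordSys.trans _ _ (FreeGC.map (cw n) _ ((s i).1 e')) at h3
        rw [← ha2 e i, ← ha2 e' i, FreeGC.map_map, FreeGC.map_map] at h3
        rw [CoordSys.map_trans (coords_over _ e _) (coords_over _ e' _), FreeGC.map_map,
          FreeGC.map_map]
        exact h3
    refine ⟨⟨a, mem_fnAlg hap⟩, ⟨hap, fun i => Subtype.ext (funext fun e => ha2 e i)⟩, ?_⟩
    rintro b ⟨hb1, hb2⟩
    refine Subtype.ext (funext fun e => ?_)
    refine FreeGC.sep hw (d := d) (fun i => U i ⊓ e.dom)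
      (fun i => inf_le_inf_right e.dom (hU i)) ?_ (hb1.1 e) (ha1 e) ?_
    · intro x hx
      obtain ⟨i, hi⟩ := hV x hx.1
      exact ⟨i, hi, hx.2⟩
    · intro i
      rw [ha2 e i]
      exact congrFun (congrArg Subtype.val (hb2 i)) e
  locally_free x := by
    let e : Chart n M := ⟨chartAt (E n) x, IsManifold.chart_mem_maximalAtlas x⟩
    refine ⟨e.dom, mem_chart_source _ x, CGen n, inferInstance, cw n, cw_pos,
      fun g => ⟨famLoc e le_rfl (FreeGC.gen _ (cw n) g),
        mem_fnAlg (famLoc_mem e le_rfl (FreeGC.gen_mem g))⟩,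
      fun g => famLoc_mem e le_rfl (FreeGC.gen_mem g), fun W' h => ?_⟩
    have hmem : ∀ a, famLoc e h a ∈ fnAlg n W' := by
      intro a
      have ha : a ∈ ⨆ d, FreeGC.deg _ (cw n) d := by rw [FreeGC.iSup_deg]; trivial
      induction ha using Submodule.iSup_induction' with
      | zero => rw [map_zero]; exact zero_mem _
      | add x y _ _ hx hy => rw [map_add]; exact add_mem hx hy
      | mem i x hx => exact mem_fnAlg (famLoc_mem e h hx)
    refine ⟨AlgEquiv.ofBijective ((famLoc e h).codRestrict (fnAlg n W') hmem) ⟨?_, ?_⟩, ?_, ?_⟩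
    · intro a b hab
      have := congrFun (congrArg Subtype.val hab) e
      change famLoc e h a e = famLoc e h b e at this
      rw [← famLoc_left e h a, ← famLoc_left e h b, this]
    · intro F
      exact ⟨_, Subtype.ext (famLoc_right e h F.2)⟩
    · intro f
      refine Subtype.ext (funext fun e' => ?_)
      change famLoc e h (FreeGC.fn (cw n) f) e' = FreeGC.fn (cw n) _
      rw [famLoc_apply, FreeGC.map_fn, CoordSys.trans_cf]
      rfl
    · intro g
      refine Subtype.ext (funext fun e' => ?_)
      change famLoc e h (FreeGC.gen _ (cw n) g) e' =
        FreeGC.map (cw n) _ (famLoc e le_rfl (FreeGC.gen _ (cw n) g) e')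
      rw [famLoc_apply, famLoc_apply, CoordSys.map_trans (coords_over _ e' _) (coords_over _ e _),
        FreeGC.map_gen, FreeGC.map_gen, FreeGC.map_gen]
  Q_mem U d x hx := famQ_mem hH hx
  Q_mul U d x y hx := Subtype.ext (famQ_mul H y.1 hx)
  Q_sq U x := Subtype.ext (famQ_sq hH x.1)
  res_Q h x := Subtype.ext (famQ_res H h x.1)

end NQ

namespace NQ

open scoped BigOperators Manifold ContDiff Topology
open TopologicalSpace

/-! ### The shift of the momenta in a single coordinate system. -/

namespace CoordSys

universe u

variable {R S : Type u} [CommRing R] [Algebra ℝ R] [CommRing S] [Algebra ℝ S] {n : ℕ}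

/-! Write `ι_k H = (1/2) φ_ijk ξ^i ξ^j` (this is `contr φ k`), so that `Q_H θ_k = p_k - ι_k H`. Take
the degree 2 functions `p̃_k = Q_H θ_k` as coordinates in place of the `p_k`; this is an invertible
change of fibre coordinates, since `ι_k H` involves only `q` and `ξ`. In the coordinates `(q, ξ, θ,
p̃)` the vector field reads `Q_H q^i = ξ^i`, `Q_H ξ^i = 0`, `Q_H θ_k = p̃_k` and `Q_H p̃_k = Q_H
(Q_H θ_k) = 0`. These are the formulas of `Q_0`, and `H` has disappeared. No primitive of `H` is
involved, so the argument is insensitive to the class `[H]`.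

In other words, `T*[2]T[1]M` with `Q_0` is `T[1]T*[1]M` with its de Rham differential, where `ξ =
dq` and `p = dθ`, and the 3-form only changes the choice of functions called `p`. There is no
conflict with the classification by the Ševera class, which concerns symplectic isomorphisms: the
bracket of `p̃_j` with `θ_k` is `φ_ikj ξ^i` up to sign, so the shift is not symplectic as soon as
`H` is nonzero.

As a pullback of functions, the isomorphism fixes `q`, `ξ`, `θ` and sends `p_k` to `p_k - ι_k H`; it
maps functions on the standard algebroid to functions on the one of `H`. Two facts carry the proof.
The first is `Q_shift`: the two vector fields agree through the shift on generators, where the case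
of `θ` is the definition of `p̃`, and the case of `p` is `Q_contr_eq`, that is `Q_H (ι_k H) = Q_H
p_k`, the place where closedness of `H` enters the comparison.

The second is `trans_shift`: the shifts in different charts agree. The law of the `p_k` is affine,
with a term in `ξθ` containing second derivatives, but its linear part in `p` is the Jacobian by
which the covector components `ι_k H` transform (`trans_contr`). Subtracting `ι_k H` is therefore
independent of the chart. The rest assembles the chartwise shifts into an automorphism of the sheaf
of functions over the identity of `M`. -/

/-- Values on the fibre coordinates of the shift `pₖ ↦ pₖ - (1/2) φᵢⱼₖ ξⁱξʲ`. -/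
noncomputable def shiftGen (φ : Fin n → Fin n → Fin n → R) : CGen n → CAlg R n
  | CGen.xi i => xi i
  | CGen.th i => th i
  | CGen.p k => pp k - contr φ k

/-- The correction `contr φ k` is quadratic in the degree 1 coordinates `ξ`, so it has the degree 2
of `p_k`. Homogeneity of the images also supplies the graded commutation needed to extend them to an
algebra map. -/
theorem shiftGen_mem (φ : Fin n → Fin n → Fin n → R) (g : CGen n) :
    shiftGen φ g ∈ FreeGC.deg R (cw n) (cw n g) := by
  rcases g with i | i | i
  · exact xi_mem i
  · exact th_mem i
  · exact Submodule.sub_mem _ (pp_mem i) (contr_mem φ i)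

/-- The shift `pₖ ↦ pₖ - (1/2) φᵢⱼₖ ξⁱξʲ`, fixing `q`, `ξ` and `θ`. -/
noncomputable def shiftHom (φ : Fin n → Fin n → Fin n → R) : CAlg R n →ₐ[ℝ] CAlg R n :=
  FreeGC.lift (cw n) cf (shiftGen φ) (fun _ _ => FreeGC.fn_comm _ _)
    (fun g h => FreeGC.comm_of_mem (shiftGen_mem φ g) (shiftGen_mem φ h))

variable (φ : Fin n → Fin n → Fin n → R)

theorem shiftHom_cf (f : R) : shiftHom φ (cf f) = cf f := FreeGC.lift_fn _ _ _ _ _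
theorem shiftHom_xi (i : Fin n) : shiftHom φ (xi i) = xi i := FreeGC.lift_gen _ _ _ _ _
theorem shiftHom_th (i : Fin n) : shiftHom φ (th i) = th i := FreeGC.lift_gen _ _ _ _ _
theorem shiftHom_pp (k : Fin n) : shiftHom φ (pp k) = pp k - contr φ k :=
  FreeGC.lift_gen _ _ _ _ _

theorem shiftHom_cf_mem (f : R) : shiftHom φ (cf f) ∈ FreeGC.deg R (cw n) 0 := by
  rw [shiftHom_cf]; exact cf_mem f

theorem shiftHom_gen_mem (g : CGen n) :
    shiftHom φ (FreeGC.gen R (cw n) g) ∈ FreeGC.deg R (cw n) (cw n g) := by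
  rw [shiftHom, FreeGC.lift_gen]; exact shiftGen_mem φ g

theorem shiftHom_mem {k : ℕ} {x : CAlg R n} (hx : x ∈ FreeGC.deg R (cw n) k) :
    shiftHom φ x ∈ FreeGC.deg R (cw n) k :=
  FreeGC.map_deg _ (shiftHom_cf_mem φ) (shiftHom_gen_mem φ) hx

/-- Only functions of `q` and the `ξ` occur in `contr`, and the shift fixes both. Hence shifts
compose by adding their corrections, and in particular they are invertible. -/
theorem shiftHom_contr (ψ : Fin n → Fin n → Fin n → R) (k : Fin n) :
    shiftHom φ (contr ψ k) = contr ψ k := by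
  simp only [contr, map_smul, map_sum, map_mul, shiftHom_cf, shiftHom_xi]

theorem contr_neg (k : Fin n) : contr (-φ) k = - contr φ k := by
  simp [contr]

theorem contr_zero (k : Fin n) : contr (0 : Fin n → Fin n → Fin n → R) k = 0 := by
  simp [contr]

/-- The correction made by the inner shift passes unchanged through the outer one, so on `p` the two
corrections cancel. Neither antisymmetry nor closedness of `φ` plays a role here. -/
theorem shiftHom_neg (x : CAlg R n) : shiftHom φ (shiftHom (-φ) x) = x := by
  have : (shiftHom φ).comp (shiftHom (-φ)) = AlgHom.id ℝ (CAlg R n) := by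
    refine FreeGC.hom_ext (fun f => ?_) ?_
    · change shiftHom φ (shiftHom (-φ) (cf f)) = cf f
      rw [shiftHom_cf, shiftHom_cf]
    · rintro (i | i | i)
      · change shiftHom φ (shiftHom (-φ) (xi i)) = xi i
        rw [shiftHom_xi, shiftHom_xi]
      · change shiftHom φ (shiftHom (-φ) (th i)) = th i
        rw [shiftHom_th, shiftHom_th]
      · change shiftHom φ (shiftHom (-φ) (pp i)) = pp i
        rw [shiftHom_pp, map_sub, shiftHom_contr, shiftHom_pp, contr_neg]
        abel
  exact DFunLike.congr_fun this x

/-- The shift `pₖ ↦ pₖ - (1/2) φᵢⱼₖ ξⁱξʲ` as an automorphism. -/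
noncomputable def shift : CAlg R n ≃ₐ[ℝ] CAlg R n :=
  AlgEquiv.ofAlgHom (shiftHom φ) (shiftHom (-φ)) (AlgHom.ext (shiftHom_neg φ))
    -- The other composite is the same identity applied to `-φ`, because `-(-φ) = φ`.
    (AlgHom.ext fun x => by simpa using shiftHom_neg (-φ) x)

theorem shift_apply (x : CAlg R n) : shift φ x = shiftHom φ x := rfl

theorem shift_symm_apply (x : CAlg R n) : (shift φ).symm x = shiftHom (-φ) x := rfl

/-! ### Compatibility of the shift with `Q`, with changes of coordinates and with restriction. -/

/-- The shift by a closed `φ` intertwines the homological vector fields of `0` and of `φ`. -/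
theorem Q_shift (c : CoordSys R n) {φ : Fin n → Fin n → Fin n → R} (hc : c.IsClosedForm φ)
    (x : CAlg R n) : c.Q φ (shift φ x) = shift φ (c.Q 0 x) := by
  -- The shift preserves degree, hence parity, so two odd derivations intertwined by it on functions
  -- of `q` and on the fibre coordinates are intertwined everywhere.
  refine FreeGC.intertwine (shiftHom φ) (shiftHom_cf_mem φ) (shiftHom_gen_mem φ) (c.Q 0) (c.Q φ)
    (c.Q_mul 0) (c.Q_mul φ) (fun f => ?_) ?_ x
  · change c.Q φ (shiftHom φ (cf f)) = shiftHom φ (c.Q 0 (cf f))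
    rw [shiftHom_cf, Q_cf, Q_cf, map_sum]
    simp only [map_mul, shiftHom_cf, shiftHom_xi]
  · rintro (i | i | i)
    · change c.Q φ (shiftHom φ (xi i)) = shiftHom φ (c.Q 0 (xi i))
      rw [shiftHom_xi, Q_xi, Q_xi, map_zero]
    -- This case dictates the shift: `Q 0` sends `θ_i` to `p_i`, so the image of `p_i` has to be the
    -- value of `c.Q φ` on `θ_i`, namely `p_i - contr φ i`.
    · change c.Q φ (shiftHom φ (th i)) = shiftHom φ (c.Q 0 (th i))
      rw [shiftHom_th, Q_th, Q_th, contr_zero, sub_zero, shiftHom_pp]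
    -- Closedness enters here: `Q_contr_eq` says that `c.Q φ` kills `p_i - contr φ i`. On the other
    -- side `Q 0` kills `p_i`, because its value there is built from derivatives of the zero
    -- components.
    · change c.Q φ (shiftHom φ (pp i)) = shiftHom φ (c.Q 0 (pp i))
      rw [shiftHom_pp, map_sub, c.Q_contr_eq hc, sub_self, Q_pp]
      simp [cubic]

/-- The shift by a tensorial `φ` commutes with changes of coordinates. -/
theorem trans_shift {c c' : CoordSys R n} {φ φ' : Fin n → Fin n → Fin n → R} (h : Compat c c')
    (hφ : Tensorial c c' φ φ') (x : CAlg R n) :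
    trans c c' (shift φ' x) = shift φ (trans c c' x) := by
  have : (trans c c').comp (shiftHom φ') = (shiftHom φ).comp (trans c c') := by
    refine FreeGC.hom_ext (fun f => ?_) ?_
    · change trans c c' (shiftHom φ' (cf f)) = shiftHom φ (trans c c' (cf f))
      rw [shiftHom_cf, trans_cf, shiftHom_cf]
    · rintro (i | i | i)
      · change trans c c' (shiftHom φ' (xi i)) = shiftHom φ (trans c c' (xi i))
        simp only [shiftHom_xi, trans_xi, map_sum, map_mul, shiftHom_cf]
      · change trans c c' (shiftHom φ' (th i)) = shiftHom φ (trans c c' (th i))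
        simp only [shiftHom_th, trans_th, map_sum, map_mul, shiftHom_cf]
      -- The inhomogeneous term of the law of `p` lies in `ξθ`, which the shift fixes, so it is the
      -- same on both sides. What remains is that the corrections transform by the matrix which is
      -- the linear part of that law, and this is `trans_contr`.
      · change trans c c' (shiftHom φ' (pp i)) = shiftHom φ (trans c c' (pp i))
        rw [shiftHom_pp, map_sub, trans_contr h hφ, trans_pp]
        simp only [map_add, map_sum, map_mul, shiftHom_cf, shiftHom_xi, shiftHom_th, shiftHom_pp,
          mul_sub, Finset.sum_sub_distrib]
        abel
  exact DFunLike.congr_fun this x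

/-- The shift involves the components `φ` but none of their derivatives, so any algebra map `ρ` will
do and no coordinate system has to be carried along. It is used with `ρ` the restriction of smooth
functions. -/
theorem map_shift (ρ : R →ₐ[ℝ] S) (x : CAlg R n) : FreeGC.map (cw n) ρ (shift φ x) =
    shift (fun i j k => ρ (φ i j k)) (FreeGC.map (cw n) ρ x) := by
  have : (FreeGC.map (cw n) ρ).comp (shiftHom φ) =
      (shiftHom fun i j k => ρ (φ i j k)).comp (FreeGC.map (cw n) ρ) := by
    refine FreeGC.hom_ext (fun f => ?_) ?_
    · simp only [AlgHom.comp_apply]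
      rw [shiftHom_cf, FreeGC.map_fn, shiftHom_cf]
    · rintro (i | i | i)
      · change FreeGC.map (cw n) ρ (shiftHom φ (xi i)) = shiftHom _ (FreeGC.map (cw n) ρ (xi i))
        rw [shiftHom_xi, map_xi, shiftHom_xi]
      · change FreeGC.map (cw n) ρ (shiftHom φ (th i)) = shiftHom _ (FreeGC.map (cw n) ρ (th i))
        rw [shiftHom_th, map_th, shiftHom_th]
      · change FreeGC.map (cw n) ρ (shiftHom φ (pp i)) = shiftHom _ (FreeGC.map (cw n) ρ (pp i))
        rw [shiftHom_pp, map_sub, map_pp, map_contr, shiftHom_pp]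
  exact DFunLike.congr_fun this x

end CoordSys

-- The shift on families of local functions over `M`.

universe u

variable {n : ℕ} {M : Type u} [TopologicalSpace M] [ChartedSpace (E n) M]

/-- The standard vector field is built from the components of the zero form, while `Q_shift` speaks
of the zero family of components; this identifies the two. -/
theorem DiffForm.comp_zero {W : Opens M} (e : Chart n M) (hW : W ≤ e.dom) :
    (0 : DiffForm n M 3).comp e hW = 0 := by
  funext i j k
  ext x
  change formRep (0 : DiffForm n M 3).toFun e (e.1 x) ![bv i, bv j, bv k] = 0
  rw [DiffForm.formRep_zero]
  rfl

/-- The shift of the momenta by the `3`-form `H`, in each chart `pₖ ↦ pₖ - (1/2) φᵢⱼₖ ξⁱξʲ`. -/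
noncomputable def famShift (H : DiffForm n M 3) (U : Opens M) : Fam n U ≃ₐ[ℝ] Fam n U :=
  AlgEquiv.piCongrRight fun e => CoordSys.shift (H.comp e inf_le_right)

variable (H : DiffForm n M 3) {U V : Opens M}

theorem famShift_apply (F : Fam n U) (e : Chart n M) :
    famShift H U F e = CoordSys.shift (H.comp e inf_le_right) (F e) := rfl

/-- The components of `H` over `U ⊓ e.dom` restrict by definition to its components over `W`, so
`map_shift` applies as it stands. -/
theorem map_famShift (F : Fam n U) (e : Chart n M) {W : Opens M} (hU : W ≤ U) (h : W ≤ e.dom) :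
    FreeGC.map (cw n) (resF (le_inf hU h)) (famShift H U F e) =
      CoordSys.shift (H.comp e h) (FreeGC.map (cw n) (resF (le_inf hU h)) (F e)) :=
  CoordSys.map_shift _ _ _

/-- Over `W`, the shift in the chart `e'` can be moved past the change of coordinates, where it
becomes the shift in the chart `e`. Both sides of the compatibility equation then carry the same
automorphism, which cancels by injectivity. Having an equivalence settles the inverse shift at the
same time. -/
theorem isCompat_famShift_iff {F : Fam n U} : IsCompat (famShift H U F) ↔ IsCompat F := by
  refine forall₂_congr fun e e' => forall₄_congr fun W hU h h' => ?_
  rw [map_famShift H F e hU h, map_famShift H F e' hU h',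
    CoordSys.trans_shift (compat e e' h h') (H.comp_tensorial e e' h h'), EquivLike.apply_eq_iff_eq]

/-- Degree and compatibility are treated separately. The equivalence is the form in which an
isomorphism of NQ manifolds must preserve degrees. -/
theorem famShift_mem_piece_iff {F : Fam n U} {d : ℕ} :
    famShift H U F ∈ piece n U d ↔ F ∈ piece n U d := by
  refine and_congr (forall_congr' fun e => ⟨fun h => ?_, CoordSys.shiftHom_mem _⟩)
    (isCompat_famShift_iff H)
  -- The inverse of the shift in a chart is again a shift, by the opposite components, so it too
  -- preserves degree.
  have := CoordSys.shiftHom_mem (-(H.comp e inf_le_right)) h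
  rwa [← CoordSys.shift_symm_apply, famShift_apply, AlgEquiv.symm_apply_apply] at this

/-- Functions are sums of homogeneous compatible families, so it is enough to know that each
homogeneous piece is preserved. -/
theorem famShift_mem {F : Fam n U} (hF : F ∈ fnAlg n U) : famShift H U F ∈ fnAlg n U :=
  fnAlg_le (famShift H U).toLinearMap
    (fun _ _ h => mem_fnAlg ((famShift_mem_piece_iff H).2 h)) hF

/-- This follows from `famShift_mem_piece_iff` read backwards, so the inverse need not be described
as the shift by a form `-H`. -/
theorem famShift_symm_mem {F : Fam n U} (hF : F ∈ fnAlg n U) :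
    (famShift H U).symm F ∈ fnAlg n U := by
  refine fnAlg_le (famShift H U).symm.toLinearMap (fun d F h => mem_fnAlg (d := d) ?_) hF
  rw [← famShift_mem_piece_iff H]
  change famShift H U ((famShift H U).symm F) ∈ _
  rwa [AlgEquiv.apply_symm_apply]

theorem famShift_res (h : U ≤ V) (F : Fam n V) :
    famShift H U (famRes h F) = famRes h (famShift H V F) := by
  funext e
  rw [famShift_apply, famRes_apply, famRes_apply, famShift_apply, CoordSys.map_shift]
  simp only [DiffForm.resF_comp]

/-- The shift fixes functions of `q` in every chart: it covers the identity of `M`. -/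
theorem famShift_famOf (f : SF n U) : famShift H U (famOf U f) = famOf U f := by
  funext e
  exact CoordSys.shiftHom_cf _ _

/-- The vector fields act chart by chart, so this is `Q_shift` on each `U ⊓ e.dom`, with
`comp_closed` turning closedness of `H` into the condition on its components. The direction makes
`famShift H` a pullback from the standard algebroid to the one of `H`. -/
theorem famShift_famQ {H : DiffForm n M 3} (hH : H.IsClosed) (F : Fam n U) :
    famShift H U (famQ 0 U F) = famQ H U (famShift H U F) := by
  funext e
  rw [famShift_apply, famQ_apply, famQ_apply, famShift_apply,
    CoordSys.Q_shift _ (H.comp_closed e inf_le_right hH), DiffForm.comp_zero]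

/-! ### The isomorphism of NQ manifolds. -/

/-- The shift of the momenta, on functions on `T*[2]T[1]M`. -/
noncomputable def fnShift (U : Opens M) : fnAlg n U ≃ₐ[ℝ] fnAlg n U where
  toFun F := ⟨famShift H U F.1, famShift_mem H F.2⟩
  invFun F := ⟨(famShift H U).symm F.1, famShift_symm_mem H F.2⟩
  left_inv F := Subtype.ext ((famShift H U).symm_apply_apply F.1)
  right_inv F := Subtype.ext ((famShift H U).apply_symm_apply F.1)
  map_mul' F F' := Subtype.ext (map_mul (famShift H U) F.1 F'.1)
  map_add' F F' := Subtype.ext (map_add (famShift H U) F.1 F'.1)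
  commutes' r := Subtype.ext ((famShift H U).commutes r)

/-- The shift of the momenta by `H` identifies the exact Courant algebroid of `H` with the standard
one, as NQ manifolds. -/
noncomputable def exactCourantIso [IsManifold (𝓡 n) ∞ M] {H : DiffForm n M 3} (hH : H.IsClosed) :
    NQManifold.Iso (exactCourant H hH) (exactCourant (0 : DiffForm n M 3) DiffForm.isClosed_zero) where
  base := Diffeomorph.refl (𝓡 n) M ∞
  -- The preimage of `V` under the identity is `V` by definition, so an automorphism of the
  -- functions over `V` has the required type. Both algebroids have the same sheaf of functions and
  -- differ only in `Q`.
  pull V := fnShift H V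
  pull_mem V d y := (famShift_mem_piece_iff H (F := y.1)).symm
  pull_res h y := Subtype.ext (famShift_res H h y.1)
  pull_ofFn V f g hg := by
    -- Over the identity of `M`, `hg` says that `g` and `f` agree pointwise.
    obtain rfl : g = f := by
      ext x
      exact hg x
    exact Subtype.ext (famShift_famOf H g)
  pull_Q V y := Subtype.ext (famShift_famQ hH y.1)

end NQ

theorem mainTheorem2 {n : ℕ} {M : Type*} [TopologicalSpace M]
    [ChartedSpace (EuclideanSpace ℝ (Fin n)) M]
    [IsManifold (modelWithCornersSelf ℝ (EuclideanSpace ℝ (Fin n))) (⊤ : ℕ∞) M]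
    (H : NQ.DiffForm n M 3) (hH : H.IsClosed) :
    Nonempty (NQ.NQManifold.Iso (NQ.exactCourant H hH)
      (NQ.exactCourant (0 : NQ.DiffForm n M 3) NQ.DiffForm.isClosed_zero)) :=
  ⟨NQ.exactCourantIso hH⟩
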